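/- Let $n\ge 2$. A convex body in $\mathbb{R}^n$ is a compact convex set with nonempty interior. For a convex body $K$ and a point $z$ in its interior put $K^z=\{y\in\mathbb{R}^n : \langle y,x-z\rangle\le 1 \text{ for all } x\in K\}$ and $K^\circ=K^0$; the Santaló point $s(K)$ is the unique interior point $z$ of $K$ for which the volume $|K^z|$ is minimal. A convex function $f$ on an open convex set $U\subseteq\mathbb{R}^m$ is twice differentiable in the generalized sense at $x_0\in U$ if there are a linear map $d^2f(x_0):\mathbb{R}^m\to\mathbb{R}^m$, a neighbourhood $V\subseteq U$ of $x_0$ and a monotone function $\Theta$ with $\lim_{t\to0}\Theta(t)=0$ such that, for all $x\in V$, all subgradients $v$ of $f$ at $x$ and all subgradients $v_0$ of $f$ at $x_0$, $$\|v-v_0-d^2f(x_0)(x-x_0)\|\le\Theta(\|x-x_0\|)\,\|x-x_0\|.$$ The generalized Gauss–Kronecker curvature of a convex body $K$ exists at $x\in\partial K$ and equals $\kappa$ if $K$ has a unique outer unit normal $N$ at $x$, and, near $x$, $\partial K$ is the graph $\{x+u-f(u)N\}$ of a convex function $f$, defined on an open convex neighbourhood of $0$ in the hyperplane $N^\perp\cong\mathbb{R}^{n-1}$,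 with $f(0)=0$, which is twice differentiable in the generalized sense at $0$, and $\kappa$ is the product of the eigenvalues of $d^2f(0)$, i.e. $\kappa=\det d^2f(0)$. **Theorem.** Let $K$ be a convex body in $\mathbb{R}^n$ such that there is a point in the boundary of $K$ where the generalized Gauss–Kronecker curvature exists and is not $0$. Then $K$ is not a local minimum, with respect to the Hausdorff metric, of the volume product $L\mapsto |L|\,|L^{s(L)}|$ on the class of all convex bodies $L$ in $\mathbb{R}^n$: every Hausdorff neighbourhood of $K$ contains a convex body $L$ with $|L|\,|L^{s(L)}|<|K|\,|K^{s(K)}|$. Moreover, if $K=-K$, then $K$ is not a local minimum, with respect to the Hausdorff metric, of $L\mapsto|L|\,|L^\circ|$ on the class of convex bodies $L$ in $\mathbb{R}^n$ with $L=-L$. -/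

import Mathlib

open Set Filter Topology MeasureTheory

/-- `v` is a subdifferential (subgradient) at `x` of the function `f` defined on `U`. -/
def IsSubdifferentialAt {E : Type*} [NormedAddCommGroup E] [InnerProductSpace ℝ E]
    (f : E → ℝ) (U : Set E) (x v : E) : Prop :=
  ∀ y ∈ U, f x + inner ℝ v (y - x) ≤ f y

/-- The function `f` on the set `U` is twice differentiable in the generalized sense at `x₀`, with
generalized Hessian `A`: on a neighbourhood of `x₀`, all subdifferentials `v` at `x` and `v₀` at `x₀`
satisfy `‖v - v₀ - A (x - x₀)‖ ≤ Θ (‖x - x₀‖) ‖x - x₀‖`, with `Θ` monotone and tending to `0`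
at `0`. -/
def HasGeneralizedHessianAt {E : Type*} [NormedAddCommGroup E] [InnerProductSpace ℝ E]
    (f : E → ℝ) (U : Set E) (x₀ : E) (A : E →ₗ[ℝ] E) : Prop :=
  ∃ V ∈ 𝓝 x₀, V ⊆ U ∧ ∃ Θ : ℝ → ℝ, MonotoneOn Θ (Ici 0) ∧ Tendsto Θ (𝓝[>] 0) (𝓝 0) ∧
    ∀ x ∈ V, ∀ v v₀ : E, IsSubdifferentialAt f U x v → IsSubdifferentialAt f U x₀ v₀ →
      ‖v - v₀ - A (x - x₀)‖ ≤ Θ ‖x - x₀‖ * ‖x - x₀‖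

/-- `N` is an outer unit normal of `K` at `x`. -/
def IsOuterUnitNormal {E : Type*} [NormedAddCommGroup E] [InnerProductSpace ℝ E]
    (K : Set E) (x N : E) : Prop :=
  ‖N‖ = 1 ∧ ∀ y ∈ K, inner ℝ (y - x) N ≤ 0

/-- The generalized Gauss–Kronecker curvature of the convex set `K` at the boundary point `x` exists
and equals `κ`: there is a unique outer unit normal `N` at `x`, and near `x` the boundary of `K` is
the graph, over the hyperplane orthogonal to `N` and in the direction `-N`, of a convex function `f`
that is twice differentiable in the generalized sense at the origin; `κ` is the determinant of the
generalized Hessian, that is, the product of its eigenvalues (with multiplicity). -/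
def HasGeneralizedGaussCurvatureAt {E : Type*} [NormedAddCommGroup E] [InnerProductSpace ℝ E]
    (K : Set E) (x : E) (κ : ℝ) : Prop :=
  ∃ N : E, IsOuterUnitNormal K x N ∧ (∀ N' : E, IsOuterUnitNormal K x N' → N' = N) ∧
    ∃ (U : Set (ℝ ∙ N)ᗮ) (f : (ℝ ∙ N)ᗮ → ℝ) (A : (ℝ ∙ N)ᗮ →ₗ[ℝ] (ℝ ∙ N)ᗮ),
      IsOpen U ∧ 0 ∈ U ∧ ConvexOn ℝ U f ∧ f 0 = 0 ∧
      (∃ W ∈ 𝓝 x, ∀ p ∈ W, p ∈ frontier K ↔ ∃ u ∈ U, p = x + (u : E) - f u • N) ∧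
      HasGeneralizedHessianAt f U 0 A ∧ LinearMap.det A = κ

/-- The polar `K^z = {y | ∀ x ∈ K, ⟪y, x - z⟫ ≤ 1}` of `K` with respect to `z`. -/
def polarBody {E : Type*} [NormedAddCommGroup E] [InnerProductSpace ℝ E]
    (K : Set E) (z : E) : Set E :=
  {y | ∀ x ∈ K, inner ℝ y (x - z) ≤ 1}

/-- `z` is a Santaló point of `K`: among the interior points of `K` it minimizes `|K^z|`. -/
def IsSantaloPoint {n : ℕ} (K : Set (EuclideanSpace ℝ (Fin n)))
    (z : EuclideanSpace ℝ (Fin n)) : Prop :=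
  z ∈ interior K ∧ ∀ w ∈ interior K, volume (polarBody K z) ≤ volume (polarBody K w)

/-- The Santaló point `s(K)`. (It exists and is unique for every convex body with nonempty
interior.) -/
noncomputable def santaloPoint {n : ℕ} (K : Set (EuclideanSpace ℝ (Fin n))) :
    EuclideanSpace ℝ (Fin n) :=
  Classical.epsilon (IsSantaloPoint K)

/-! ### Existence of Santaló points. -/

section Santalo

open scoped Pointwise

variable {E : Type*} [NormedAddCommGroup E] [InnerProductSpace ℝ E]

/-! The Santaló point of `L` minimises the volume of the polar, so it is enough to fix an interior
point `z` of `K` (its Santaló point, or `0` in the symmetric case) and to find bodies `L` near `K`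
with smaller |L| |L^z|. In an affine chart centred at `z` both volumes change by constant factors.
`HasGeneralizedGaussCurvatureAt.exists_osculates` chooses the chart in `G × ℝ` so that the curvature
point is `(0, 1)`, the supporting hyperplane there is horizontal, and the boundary agrees to second
order with the paraboloid 1 - ‖u‖²/2. This is possible because nonzero curvature makes the
generalized Hessian positive definite. The paraboloid is self-polar to second order, so the polar of
an osculating body osculates too (`Osculates.polar`).

Now cut a cap of height ρ²/2 off the osculating body A. Rescaled by ρ horizontally and ρ²
vertically, the removed volume a is asymptotically at least the integral of (1 - ‖w‖²)/2 over the
unit ball, while the volume b gained by the polar is asymptotically at most the integral of (1 -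
‖w‖)²/2. Since (1 - r)² < 1 - r² for 0 < r < 1, b < a for small ρ
(`Osculates.measure_polarGain_lt`). If |A| ≤ |A°|, then (|A| - a)(|A°| + b) < |A| |A°|, so the cut
lowers the product. Otherwise the same cut is made in A°, and the bipolar theorem carries the result
back. When A is symmetric, two opposite caps are removed. -/

lemma isClosed_polarBody (K : Set E) (z : E) : IsClosed (polarBody K z) := by
  have : polarBody K z = ⋂ x ∈ K, {y | inner ℝ y (x - z) ≤ 1} := by
    ext y; simp [polarBody]
  rw [this]
  refine isClosed_biInter fun x _ => isClosed_le (by fun_prop) continuous_const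

/-- The polar body at an interior point is bounded. -/
lemma polarBody_subset_closedBall {K : Set E} {z : E} {r : ℝ} (hr : 0 < r)
    (hz : Metric.closedBall z r ⊆ K) : polarBody K z ⊆ Metric.closedBall 0 (1 / r) := by
  intro y hy
  rw [mem_closedBall_zero_iff]
  rcases eq_or_ne y 0 with rfl | h0
  · simp only [norm_zero]; positivity
  have hn : 0 < ‖y‖ := norm_pos_iff.2 h0
  have h := hy (z + (r / ‖y‖) • y) (hz (by
    rw [Metric.mem_closedBall, dist_eq_norm, add_sub_cancel_left, norm_smul, Real.norm_eq_abs,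
      abs_of_pos (by positivity), div_mul_cancel₀ _ hn.ne']))
  rw [add_sub_cancel_left, real_inner_smul_right, real_inner_self_eq_norm_sq] at h
  rw [le_div_iff₀ hr]
  have : r / ‖y‖ * ‖y‖ ^ 2 = ‖y‖ * r := by field_simp
  linarith

/-- A convex set with nonempty interior has a nonzero outer normal at each of its
non-interior points. -/
lemma exists_outer_normal [CompleteSpace E] {K : Set E} (hK : Convex ℝ K)
    (hi : (interior K).Nonempty) {z : E} (hz : z ∉ interior K) :
    ∃ N : E, N ≠ 0 ∧ ∀ x ∈ K, inner ℝ N (x - z) ≤ 0 := by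
  obtain ⟨f, hf⟩ := geometric_hahn_banach_open_point hK.interior isOpen_interior hz
  refine ⟨(InnerProductSpace.toDual ℝ E).symm f, ?_, ?_⟩
  · intro h
    have h0 : f = 0 := by simpa using h
    obtain ⟨a, ha⟩ := hi
    simpa [h0] using hf a ha
  · intro x hx
    have hx' : x ∈ closure (interior K) := by
      rw [hK.closure_interior_eq_closure_of_nonempty_interior hi]; exact subset_closure hx
    have hle : f x ≤ f z := by
      have hcl : IsClosed {x | f x ≤ f z} := isClosed_le f.continuous continuous_const
      exact hcl.closure_subset_iff.2 (fun a ha => (hf a ha).le) hx'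
    rw [InnerProductSpace.toDual_symm_apply, map_sub]
    linarith

variable [FiniteDimensional ℝ E] [MeasurableSpace E] [BorelSpace E]

/-- The polar body with respect to a non-interior point has infinite volume. -/
lemma measure_polarBody_eq_top {K : Set E} (μ : Measure E) [μ.IsAddHaarMeasure]
    (hK : Convex ℝ K) (hb : Bornology.IsBounded K)
    (hi : (interior K).Nonempty) {z : E} (hz : z ∉ interior K) : μ (polarBody K z) = ⊤ := by
  obtain ⟨N, hN, hNK⟩ := exists_outer_normal hK hi hz
  obtain ⟨R, hR⟩ := hb.subset_closedBall z
  set D : ℝ := max R 1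
  have hD : 0 < D := lt_of_lt_of_le one_pos (le_max_right _ _)
  have hn : 0 < ‖N‖ := norm_pos_iff.2 hN
  set r : ℝ := 1 / D
  have hr : 0 < r := by positivity
  -- `N` is a recession direction of the polar, which therefore contains balls of radius `r` along
  -- the whole ray; spacing `2 * r` makes them disjoint.
  set c : ℕ → E := fun k => ((k : ℝ) * (2 * r / ‖N‖)) • N
  have hsub : (⋃ k, Metric.ball (c k) r) ⊆ polarBody K z := by
    refine iUnion_subset fun k y hy x hx => ?_
    have h1 : ‖y - c k‖ ≤ r := by
      rw [Metric.mem_ball, dist_eq_norm] at hy; exact hy.le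
    have h2 : ‖x - z‖ ≤ D := by
      have := hR hx
      rw [Metric.mem_closedBall, dist_eq_norm] at this
      exact this.trans (le_max_left _ _)
    have h3 : inner ℝ (y - c k) (x - z) ≤ 1 :=
      calc inner ℝ (y - c k) (x - z) ≤ ‖y - c k‖ * ‖x - z‖ := real_inner_le_norm _ _
        _ ≤ r * D := by gcongr
        _ = 1 := by simp only [r]; field_simp
    have h4 : inner ℝ (c k) (x - z) ≤ 0 := by
      simp only [c]
      rw [real_inner_smul_left]
      exact mul_nonpos_of_nonneg_of_nonpos (by positivity) (hNK x hx)
    have h5 : inner ℝ y (x - z) = inner ℝ (y - c k) (x - z) + inner ℝ (c k) (x - z) := by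
      rw [← inner_add_left, sub_add_cancel]
    linarith
  have hdisj : Pairwise (Function.onFun Disjoint fun k => Metric.ball (c k) r) := by
    intro i j hij
    refine Metric.ball_disjoint_ball ?_
    rw [dist_eq_norm]
    simp only [c]
    rw [← sub_smul, norm_smul, ← sub_mul, norm_mul, Real.norm_eq_abs, Real.norm_eq_abs,
      abs_of_pos (show 0 < 2 * r / ‖N‖ by positivity), mul_assoc, div_mul_cancel₀ _ hn.ne']
    have : (1 : ℝ) ≤ |(i : ℝ) - j| := by
      have hz : (1 : ℤ) ≤ |(i : ℤ) - j| := Int.one_le_abs (by omega)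
      exact_mod_cast hz
    nlinarith
  refine eq_top_iff.2 (le_trans ?_ (measure_mono hsub))
  rw [measure_iUnion hdisj fun _ => measurableSet_ball]
  have hc : ∀ k, μ (Metric.ball (c k) r) = μ (Metric.ball 0 r) := fun k =>
    μ.addHaar_ball_center _ _
  simp only [hc]
  rw [ENNReal.tsum_const_eq_top_of_ne_zero (Metric.measure_ball_pos μ 0 hr).ne']

/-- By inner regularity a compact `C` in the polar at `z` already has measure above `c`. For `t < 1`
close to 1 so does `t • C`, and the slack `1 - t` keeps `t • C` inside the polar at every `w` near
`z`. -/
lemma lowerSemicontinuous_measure_polarBody {K : Set E} (μ : Measure E) [μ.IsAddHaarMeasure] :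
    LowerSemicontinuous fun z => μ (polarBody K z) := by
  intro z c hc
  obtain ⟨C, hCK, hC, hcC⟩ := (isClosed_polarBody K z).measurableSet.exists_lt_isCompact hc
  obtain ⟨R, hR⟩ := hC.isBounded.subset_closedBall 0
  have hlim : Tendsto (fun t : ℝ => μ (t • C)) (𝓝 1) (𝓝 (μ C)) := by
    have h1 : Tendsto (fun t : ℝ => ENNReal.ofReal |t ^ Module.finrank ℝ E| * μ C) (𝓝 1)
        (𝓝 (ENNReal.ofReal |(1 : ℝ) ^ Module.finrank ℝ E| * μ C)) := by
      refine ENNReal.Tendsto.mul_const ?_ (Or.inr hC.measure_lt_top.ne)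
      refine ENNReal.tendsto_ofReal ?_
      have : Continuous fun t : ℝ => |t ^ Module.finrank ℝ E| := by fun_prop
      exact this.tendsto 1
    simpa [Measure.addHaar_smul] using h1
  have hev : ∀ᶠ t : ℝ in 𝓝[Iio 1] 1, c < μ (t • C) ∧ 0 < t :=
    ((hlim.eventually (lt_mem_nhds hcC)).and (lt_mem_nhds one_pos)).filter_mono nhdsWithin_le_nhds
  obtain ⟨t, ⟨htc, ht0⟩, ht1⟩ := (hev.and self_mem_nhdsWithin).exists
  set D : ℝ := max R 1
  have hD : 0 < D := lt_of_lt_of_le one_pos (le_max_right _ _)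
  filter_upwards [Metric.ball_mem_nhds z (show 0 < (1 - t) / D from div_pos (by linarith) hD)]
    with w hw
  refine lt_of_lt_of_le htc (measure_mono ?_)
  rintro _ ⟨y, hy, rfl⟩ x hx
  have h1 := hCK hy x hx
  have h2 : ‖y‖ ≤ D := by
    have := hR hy
    rw [mem_closedBall_zero_iff] at this
    exact this.trans (le_max_left _ _)
  have h3 : ‖z - w‖ ≤ (1 - t) / D := by
    rw [Metric.mem_ball, dist_comm, dist_eq_norm] at hw; exact hw.le
  have h4 : inner ℝ y (z - w) ≤ 1 - t :=
    calc inner ℝ y (z - w) ≤ ‖y‖ * ‖z - w‖ := real_inner_le_norm _ _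
      _ ≤ D * ((1 - t) / D) := by gcongr
      _ = 1 - t := by field_simp
  have h5 : inner ℝ y (x - w) = inner ℝ y (x - z) + inner ℝ y (z - w) := by
    rw [← inner_add_right, sub_add_sub_cancel]
  simp only [real_inner_smul_left, h5]
  nlinarith

end Santalo

/-- Every convex body with nonempty interior has a Santaló point. -/
lemma exists_isSantaloPoint {n : ℕ} (K : ConvexBody (EuclideanSpace ℝ (Fin n)))
    (hK : (interior (K : Set (EuclideanSpace ℝ (Fin n)))).Nonempty) :
    ∃ z, IsSantaloPoint (K : Set (EuclideanSpace ℝ (Fin n))) z := by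
  obtain ⟨z, hz, hmin⟩ := LowerSemicontinuousOn.exists_isMinOn K.nonempty K.isCompact
    ((lowerSemicontinuous_measure_polarBody (K := (K : Set (EuclideanSpace ℝ (Fin n))))
      volume).lowerSemicontinuousOn _)
  refine ⟨z, ?_, fun w hw => hmin (interior_subset hw)⟩
  -- A minimiser over the compact body exists; on the boundary its value would be infinite, while
  -- interior points give finite values.
  by_contra hzi
  obtain ⟨w, hw⟩ := hK
  have h1 : volume (polarBody (K : Set (EuclideanSpace ℝ (Fin n))) z) ≤
      volume (polarBody (K : Set (EuclideanSpace ℝ (Fin n))) w) := hmin (interior_subset hw)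
  rw [measure_polarBody_eq_top volume K.convex K.isCompact.isBounded ⟨w, hw⟩ hzi, top_le_iff] at h1
  obtain ⟨r, hr, hrK⟩ := Metric.nhds_basis_closedBall.mem_iff.1 (mem_interior_iff_mem_nhds.1 hw)
  have h2 := (measure_mono (μ := volume) (polarBody_subset_closedBall hr hrK)).trans_lt
    measure_closedBall_lt_top
  exact h2.ne h1

lemma isSantaloPoint_santaloPoint {n : ℕ} (K : ConvexBody (EuclideanSpace ℝ (Fin n)))
    (hK : (interior (K : Set (EuclideanSpace ℝ (Fin n)))).Nonempty) :
    IsSantaloPoint (K : Set (EuclideanSpace ℝ (Fin n)))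
      (santaloPoint (K : Set (EuclideanSpace ℝ (Fin n)))) :=
  Classical.epsilon_spec (exists_isSantaloPoint K hK)

/-- `A` lies in the half-space `{q | q.2 ≤ 1}`, and near `(0, 1)` its boundary osculates the
paraboloid `q.2 = 1 - ‖q.1‖ ^ 2 / 2` to second order. -/
def Osculates {G : Type*} [NormedAddCommGroup G] (A : Set (G × ℝ)) : Prop :=
  (∀ q ∈ A, q.2 ≤ 1) ∧ ∀ ε : ℝ, 0 < ε → ε ≤ 1 → ∃ r > 0, ∀ (u : G) (s : ℝ), ‖u‖ < r → |s| < r →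
    ((u, 1 - s) ∈ A → (1 - ε) * ‖u‖ ^ 2 / 2 ≤ s) ∧
    ((1 + ε) * ‖u‖ ^ 2 / 2 ≤ s → (u, 1 - s) ∈ A)

lemma Osculates.top_mem {G : Type*} [NormedAddCommGroup G] {A : Set (G × ℝ)} (h : Osculates A) :
    ((0 : G), (1 : ℝ)) ∈ A := by
  obtain ⟨r, hr, H⟩ := h.2 1 one_pos le_rfl
  simpa using (H 0 0 (by simpa using hr) (by simpa using hr)).2 (by simp)

/-! ### Polarity in `G × ℝ` and the duality of osculation. -/

section Model

variable {G : Type*} [NormedAddCommGroup G] [InnerProductSpace ℝ G]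

/-- The standard pairing on `G × ℝ`. -/
def pairing (p q : G × ℝ) : ℝ := inner ℝ p.1 q.1 + p.2 * q.2

/-- The polar of a subset of `G × ℝ` with respect to the origin. -/
def pairingPolar (A : Set (G × ℝ)) : Set (G × ℝ) := {p | ∀ q ∈ A, pairing p q ≤ 1}

lemma pairing_comm (p q : G × ℝ) : pairing p q = pairing q p := by
  simp only [pairing, real_inner_comm, mul_comm]

lemma pairing_add_left (p p' q : G × ℝ) : pairing (p + p') q = pairing p q + pairing p' q := by
  simp only [pairing, Prod.fst_add, Prod.snd_add, inner_add_left]; ring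

lemma pairing_smul_left (a : ℝ) (p q : G × ℝ) : pairing (a • p) q = a * pairing p q := by
  simp only [pairing, Prod.smul_fst, Prod.smul_snd, real_inner_smul_left, smul_eq_mul]; ring

lemma pairing_smul_right (a : ℝ) (p q : G × ℝ) : pairing p (a • q) = a * pairing p q := by
  rw [pairing_comm, pairing_smul_left, pairing_comm]

lemma pairing_neg_left (p q : G × ℝ) : pairing (-p) q = -pairing p q := by
  simp only [pairing, Prod.fst_neg, Prod.snd_neg, inner_neg_left]; ring

lemma pairing_neg_right (p q : G × ℝ) : pairing p (-q) = -pairing p q := by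
  rw [pairing_comm, pairing_neg_left, pairing_comm]

lemma continuous_pairing_left (q : G × ℝ) : Continuous fun p => pairing p q := by
  unfold pairing; fun_prop

/-- `G × ℝ` carries the sup norm, which is not the norm of `pairing`; hence the factor 2. -/
lemma pairing_le (p q : G × ℝ) : pairing p q ≤ 2 * (‖p‖ * ‖q‖) := by
  have h1 : inner ℝ p.1 q.1 ≤ ‖p‖ * ‖q‖ := (real_inner_le_norm _ _).trans
    (mul_le_mul (norm_fst_le p) (norm_fst_le q) (norm_nonneg _) (norm_nonneg _))
  have h2 : p.2 * q.2 ≤ ‖p‖ * ‖q‖ := by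
    refine (le_abs_self _).trans ?_
    rw [abs_mul]
    exact mul_le_mul (norm_snd_le p) (norm_snd_le q) (abs_nonneg _) (norm_nonneg _)
  simp only [pairing]; linarith

lemma norm_sq_le_pairing_self (p : G × ℝ) : ‖p‖ ^ 2 ≤ pairing p p := by
  simp only [pairing, real_inner_self_eq_norm_sq, Prod.norm_def, Real.norm_eq_abs]
  rcases max_cases ‖p.1‖ |p.2| with ⟨h, _⟩ | ⟨h, _⟩ <;> rw [h]
  · nlinarith [mul_self_nonneg p.2]
  · rw [sq_abs]; nlinarith [sq_nonneg ‖p.1‖]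

lemma isClosed_pairingPolar (A : Set (G × ℝ)) : IsClosed (pairingPolar A) := by
  have : pairingPolar A = ⋂ q ∈ A, {p | pairing p q ≤ 1} := by
    ext y; simp [pairingPolar]
  rw [this]
  exact isClosed_biInter fun x _ => isClosed_le (continuous_pairing_left x) continuous_const

lemma convex_pairingPolar (A : Set (G × ℝ)) : Convex ℝ (pairingPolar A) := by
  intro p hp p' hp' a b ha hb hab q hq
  rw [pairing_add_left, pairing_smul_left, pairing_smul_left]
  nlinarith [mul_le_mul_of_nonneg_left (hp q hq) ha, mul_le_mul_of_nonneg_left (hp' q hq) hb]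

lemma pairingPolar_anti {A B : Set (G × ℝ)} (h : A ⊆ B) : pairingPolar B ⊆ pairingPolar A :=
  fun _ hp q hq => hp q (h hq)

lemma isBounded_pairingPolar {A : Set (G × ℝ)} (h0 : 0 ∈ interior A) :
    Bornology.IsBounded (pairingPolar A) := by
  obtain ⟨r, hr, hrA⟩ := Metric.nhds_basis_closedBall.mem_iff.1 (mem_interior_iff_mem_nhds.1 h0)
  refine (Metric.isBounded_closedBall (x := 0) (r := 1 / r)).subset fun p hp => ?_
  rw [mem_closedBall_zero_iff]
  rcases eq_or_ne p 0 with rfl | hp0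
  · simp only [norm_zero]; positivity
  have hn : 0 < ‖p‖ := norm_pos_iff.2 hp0
  have h := hp ((r / ‖p‖) • p) (hrA (by
    rw [mem_closedBall_zero_iff, norm_smul, Real.norm_eq_abs,
      abs_of_pos (by positivity), div_mul_cancel₀ _ hn.ne']))
  rw [pairing_smul_right] at h
  rw [le_div_iff₀ hr]
  have h2 : r / ‖p‖ * ‖p‖ ^ 2 = ‖p‖ * r := by field_simp
  have h3 := mul_le_mul_of_nonneg_left (norm_sq_le_pairing_self p)
    (show 0 ≤ r / ‖p‖ by positivity)
  linarith

lemma isCompact_pairingPolar [FiniteDimensional ℝ G] {A : Set (G × ℝ)} (h0 : 0 ∈ interior A) :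
    IsCompact (pairingPolar A) := by
  have : ProperSpace (G × ℝ) := FiniteDimensional.proper ℝ _
  exact Metric.isCompact_of_isClosed_isBounded (isClosed_pairingPolar A)
    (isBounded_pairingPolar h0)

lemma zero_mem_interior_pairingPolar {A : Set (G × ℝ)} (hA : Bornology.IsBounded A) :
    0 ∈ interior (pairingPolar A) := by
  obtain ⟨R, hR⟩ := hA.subset_closedBall 0
  set D : ℝ := max R 1
  have hD : 0 < D := lt_of_lt_of_le one_pos (le_max_right _ _)
  rw [mem_interior_iff_mem_nhds]
  filter_upwards [Metric.ball_mem_nhds (0 : G × ℝ) (show 0 < 1 / (2 * D) by positivity)]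
    with p hp q hq
  rw [mem_ball_zero_iff] at hp
  have h2 : ‖q‖ ≤ D := by
    have := hR hq
    rw [mem_closedBall_zero_iff] at this
    exact this.trans (le_max_left _ _)
  calc pairing p q ≤ 2 * (‖p‖ * ‖q‖) := pairing_le p q
    _ ≤ 2 * (1 / (2 * D) * D) := by gcongr
    _ = 1 := by field_simp

/-- The bipolar theorem. -/
lemma pairingPolar_pairingPolar [FiniteDimensional ℝ G] {A : Set (G × ℝ)} (hA : Convex ℝ A)
    (hc : IsClosed A) (h0 : 0 ∈ A) : pairingPolar (pairingPolar A) = A := by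
  refine Subset.antisymm (fun q hq => ?_) (fun q hq p hp => ?_)
  · by_contra hqA
    obtain ⟨f, u, hfA, hfq⟩ := geometric_hahn_banach_closed_point hA hc hqA
    have hu : 0 < u := by simpa using hfA 0 h0
    have : CompleteSpace G := FiniteDimensional.complete ℝ G
    set g : StrongDual ℝ G := f.comp (ContinuousLinearMap.inl ℝ G ℝ)
    set p : G × ℝ := ((InnerProductSpace.toDual ℝ G).symm g, f (0, 1))
    have hp : ∀ x, pairing p x = f x := by
      intro x
      have hx : x = (x.1, 0) + x.2 • ((0 : G), (1 : ℝ)) := by ext <;> simp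
      conv_rhs => rw [hx, map_add, map_smul]
      simp only [pairing, p, InnerProductSpace.toDual_symm_apply, g,
        ContinuousLinearMap.comp_apply, ContinuousLinearMap.inl_apply, smul_eq_mul]
      ring
    have h1 : u⁻¹ • p ∈ pairingPolar A := by
      intro x hx
      rw [pairing_smul_left, hp, inv_mul_le_iff₀ hu, mul_one]
      exact (hfA x hx).le
    have h2 := hq _ h1
    rw [pairing_smul_right, pairing_comm, hp, inv_mul_le_iff₀ hu, mul_one] at h2
    linarith
  · rw [pairing_comm]; exact hp q hq

/-- Small caps at `(0, 1)` have small diameter. -/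
lemma Osculates.exists_cap_small {A : Set (G × ℝ)} (h : Osculates A) (hA : Convex ℝ A) {r : ℝ}
    (hr : 0 < r) : ∃ δ > 0, ∀ (u : G) (s : ℝ), (u, 1 - s) ∈ A → s < δ → ‖u‖ < r := by
  obtain ⟨r₀, hr₀, H⟩ := h.2 (1 / 2) (by norm_num) (by norm_num)
  set a : ℝ := min r r₀ / 2
  have ha : 0 < a := by positivity
  have har : a < r := by
    have := min_le_left r r₀; simp only [a]; linarith
  have har₀ : a < r₀ := by
    have := min_le_right r r₀; simp only [a]; linarith
  refine ⟨min r₀ (a ^ 2 / 4), by positivity, fun u s hus hs => ?_⟩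
  by_contra! hur
  have hs0 : 0 ≤ s := by
    have := h.1 _ hus; simp only at this; linarith
  have hu : 0 < ‖u‖ := hr.trans_le hur
  -- A point far from the axis is pulled towards `(0, 1)` until its horizontal norm is exactly `a`.
  -- Its depth does not increase, yet osculation with `ε = 1 / 2` forces depth at least `a ^ 2 / 4`.
  set l : ℝ := a / ‖u‖
  have hl0 : 0 < l := by positivity
  have hl1 : l ≤ 1 := (div_le_one hu).2 (by linarith)
  have hmem : (l • u, 1 - l * s) ∈ A := by
    have := hA hus h.top_mem hl0.le (sub_nonneg.2 hl1) (by ring)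
    convert this using 1
    ext
    · simp
    · simp; ring
  have hlu : ‖l • u‖ = a := by
    rw [norm_smul, Real.norm_eq_abs, abs_of_pos hl0, div_mul_cancel₀ _ hu.ne']
  have hls : l * s ≤ s := mul_le_of_le_one_left hs0 hl1
  have h1 := (H (l • u) (l * s) (by rw [hlu]; exact har₀) (by
    rw [abs_of_nonneg (by positivity)]
    exact hls.trans_lt (hs.trans_le (min_le_left _ _)))).1 hmem
  rw [hlu] at h1
  have h2 := hs.trans_le (min_le_right _ _)
  nlinarith

/-- Osculation passes to the polar. -/
lemma Osculates.polar {A : Set (G × ℝ)} (h : Osculates A) (hA : Convex ℝ A)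
    (hb : Bornology.IsBounded A) : Osculates (pairingPolar A) := by
  have htop : ∀ p ∈ pairingPolar A, p.2 ≤ 1 := by
    intro p hp; simpa [pairing] using hp _ h.top_mem
  refine ⟨htop, fun ε hε hε1 => ?_⟩
  -- Chosen so that `1 - 2 * ε' = 1 / (1 + ε)`, whence `(1 + ε) * (1 - ε') ^ 2 ≥ 1`.
  set ε' : ℝ := ε / (2 * (1 + ε))
  have hε' : 0 < ε' := by positivity
  have hε'2 : ε' ≤ 1 / 2 := by
    simp only [ε']; rw [div_le_div_iff₀ (by positivity) (by norm_num)]; linarith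
  have hkey : 1 ≤ (1 + ε) * (1 - ε') * (1 - ε') := by
    have : ε' * (2 * (1 + ε)) = ε := by simp only [ε']; field_simp
    nlinarith [sq_nonneg ε', mul_nonneg hε.le (sq_nonneg ε')]
  obtain ⟨r₁, hr₁, H₁⟩ := h.2 ε hε hε1
  obtain ⟨r₂, hr₂, H₂⟩ := h.2 ε' hε' (by linarith)
  obtain ⟨δ₀, hδ₀, Hδ⟩ := h.exists_cap_small hA hr₂
  obtain ⟨R, hR⟩ := hb.subset_closedBall 0
  set D : ℝ := max R 1
  have hD : 0 < D := lt_of_lt_of_le one_pos (le_max_right _ _)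
  set δ : ℝ := min δ₀ r₂
  have hδ : 0 < δ := lt_min hδ₀ hr₂
  set r : ℝ := min (min r₁ 1) (min ε' (δ / (2 * D)))
  have hr : 0 < r := by positivity
  have hrr₁ : r ≤ r₁ := (min_le_left _ _).trans (min_le_left _ _)
  have hr1 : r ≤ 1 := (min_le_left _ _).trans (min_le_right _ _)
  have hrε : r ≤ ε' := (min_le_right _ _).trans (min_le_left _ _)
  have hrD : r * D ≤ δ / 2 := by
    have : r ≤ δ / (2 * D) := (min_le_right _ _).trans (min_le_right _ _)
    calc r * D ≤ δ / (2 * D) * D := by gcongr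
      _ = δ / 2 := by field_simp
  refine ⟨r, hr, fun w t hw ht => ⟨fun hp => ?_, fun hwt => ?_⟩⟩
  · have ht0 : 0 ≤ t := by
      have := htop _ hp; simp only at this; linarith
    have hw2 : ‖w‖ ^ 2 < r₁ := by
      nlinarith [norm_nonneg w]
    -- The test point `(w, 1 - s)` of `A`: in the limit paraboloid, `w` itself is the contact point
    -- of the hyperplane dual to `(w, 1 - t)`.
    set s : ℝ := (1 + ε) * ‖w‖ ^ 2 / 2
    have hs0 : 0 ≤ s := by positivity
    have h1 := (H₁ w s (by linarith) (by
      rw [abs_of_nonneg hs0]; simp only [s]; nlinarith [sq_nonneg ‖w‖])).2 le_rfl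
    have h2 := hp _ h1
    simp only [pairing, real_inner_self_eq_norm_sq] at h2
    have h3 : s = ‖w‖ ^ 2 - (1 - ε) * ‖w‖ ^ 2 / 2 := by simp only [s]; ring
    nlinarith [mul_nonneg ht0 hs0]
  · have ht0 : 0 ≤ t := le_trans (by positivity) hwt
    rw [abs_of_nonneg ht0] at ht
    rintro ⟨u, q₂⟩ hq
    obtain ⟨s, rfl⟩ : ∃ s, q₂ = 1 - s := ⟨1 - q₂, by ring⟩
    have hs0 : 0 ≤ s := by
      have := h.1 _ hq; simp only at this; linarith
    have hiwu : inner ℝ w u ≤ ‖w‖ * ‖u‖ := real_inner_le_norm _ _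
    simp only [pairing]
    suffices ‖w‖ * ‖u‖ ≤ t + s * (1 - t) by nlinarith
    -- Near the top, osculation of `A` and the inequality between arithmetic and geometric means
    -- suffice. Away from it the gap `δ` in height dominates `‖w‖ * ‖u‖`, as `‖w‖` is small.
    rcases lt_or_ge s δ with hs | hs
    · have hu := Hδ u s hq (hs.trans_le (min_le_left _ _))
      have h1 := (H₂ u s hu (by
        rw [abs_of_nonneg hs0]; exact hs.trans_le (min_le_right _ _))).1 hq
      have h2 : (1 - ε') * ‖u‖ ^ 2 / 2 * (1 - ε') ≤ s * (1 - t) := by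
        apply mul_le_mul h1 (by linarith) (by linarith) hs0
      have h3 : 0 ≤ (1 + ε) / 2 * (‖w‖ - (1 - ε') * (1 - ε') * ‖u‖) ^ 2 := by positivity
      set k : ℝ := (1 - ε') * (1 - ε')
      have hk : 0 ≤ k := mul_self_nonneg _
      have hk1 : k ≤ 1 := by simp only [k]; nlinarith
      have hkey' : 1 ≤ (1 + ε) * k := by simp only [k]; linarith
      have h2' : k * ‖u‖ ^ 2 / 2 ≤ s * (1 - t) := by
        have : (1 - ε') * ‖u‖ ^ 2 / 2 * (1 - ε') = k * ‖u‖ ^ 2 / 2 := by simp only [k]; ring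
        linarith
      have h4 : ‖w‖ * ‖u‖ ≤ (1 + ε) * ‖w‖ ^ 2 / 2 + k * ‖u‖ ^ 2 / 2 := by
        have e1 : (1 + ε) * (2 * (‖w‖ * ‖u‖)) ≤ (1 + ε) * ((1 + ε) * ‖w‖ ^ 2 + k * ‖u‖ ^ 2) := by
          have := sq_nonneg ((1 + ε) * ‖w‖ - ‖u‖)
          nlinarith [mul_le_mul_of_nonneg_right hkey' (sq_nonneg ‖u‖)]
        have := le_of_mul_le_mul_left e1 (by linarith)
        linarith
      linarith
    · have hu : ‖u‖ ≤ D := by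
        have := hR hq
        rw [mem_closedBall_zero_iff] at this
        exact (norm_fst_le _).trans (this.trans (le_max_left _ _))
      have h1 : ‖w‖ * ‖u‖ ≤ r * D := mul_le_mul hw.le hu (norm_nonneg _) hr.le
      have h2 : δ * (1 / 2) ≤ s * (1 - t) := by
        apply mul_le_mul hs (by linarith) (by norm_num) hs0
      linarith

end Model

/-! ### The volume of a small cap against the gain of the polar. -/

section Volume

variable {G : Type*} [NormedAddCommGroup G] [InnerProductSpace ℝ G]

/-- The points which are added to the polar of `A` when a cap of height `ρ ^ 2 / 2` at `(0, 1)` is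
cut off from `A`. -/
def polarGain (A : Set (G × ℝ)) (ρ : ℝ) : Set (G × ℝ) :=
  {p | (∃ q ∈ A, 1 - ρ ^ 2 / 2 < q.2 ∧ 1 < pairing p q) ∧
    ∀ q ∈ A, 1 / 2 ≤ q.2 → q.2 ≤ 1 - ρ ^ 2 / 2 → pairing p q ≤ 1}

/-- In parabolic coordinates the cap fills out `-1/2 < s < -‖u‖²/2`; the margin `η / 2` absorbs the
osculation error uniformly in `ρ`. -/
lemma Osculates.cap_contains {A : Set (G × ℝ)} (h : Osculates A) {η : ℝ} (hη : 0 < η)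
    (hη1 : η ≤ 1) : ∃ ρ₀ > 0, ∀ ρ, 0 < ρ → ρ < ρ₀ → ∀ (u : G) (s : ℝ), -(1 / 2) < s →
      s < -‖u‖ ^ 2 / 2 - η / 2 → (ρ • u, 1 + ρ ^ 2 * s) ∈ A ∩ {q | 1 - ρ ^ 2 / 2 < q.2} := by
  obtain ⟨r, hr, H⟩ := h.2 η hη hη1
  refine ⟨min r 1, by positivity, fun ρ hρ hρr u s hs hsu => ?_⟩
  have hρ1 : ρ < 1 := hρr.trans_le (min_le_right _ _)
  have hρr' : ρ < r := hρr.trans_le (min_le_left _ _)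
  have hu : ‖u‖ < 1 := by nlinarith [norm_nonneg u]
  have hρ2 : ρ ^ 2 ≤ ρ := by nlinarith
  have hn : ‖ρ • u‖ = ρ * ‖u‖ := by rw [norm_smul, Real.norm_eq_abs, abs_of_pos hρ]
  have hs0 : s < 0 := by nlinarith [sq_nonneg ‖u‖]
  have h1 := (H (ρ • u) (-(ρ ^ 2 * s)) (by rw [hn]; nlinarith [norm_nonneg u]) (by
    rw [abs_neg, abs_mul, abs_of_pos (by positivity : 0 < ρ ^ 2), abs_of_neg hs0]
    nlinarith [sq_nonneg ρ])).2 (by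
      rw [hn]
      have : (1 + η) * ‖u‖ ^ 2 / 2 ≤ -s := by nlinarith [sq_nonneg ‖u‖, norm_nonneg u]
      nlinarith [sq_nonneg ρ])
  refine ⟨by simpa using h1, ?_⟩
  simp only [mem_ofPred_eq]
  nlinarith [sq_pos_of_pos hρ]

/-- The scalar core of the gain estimate, with `W = ‖w‖`, `U = ‖u‖`, `P = ρ ^ 2`. `V` says that a
removed point at depth `s` violates the polar inequality, and bounds `t` below; `M` says that
remaining points at horizontal radius `a` satisfy it, and bounds `t` above. The terms containing `P`
are errors of size at most `η`. -/
lemma rescaled_gain_bounds {W U t s P η : ℝ} (hW : 0 ≤ W) (hU : 0 ≤ U) (hs0 : 0 ≤ s)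
    (hs1 : s < 1 / 2) (hη : 0 < η) (hη1 : η ≤ 1 / 10) (hP : 0 < P) (hPη : 36 * P ≤ η)
    (hus : (1 - η) * U ^ 2 / 2 ≤ s) (V : s - W * U < t * (1 - P * s))
    (M : ∀ a : ℝ, 1 ≤ a → a ≤ 3 →
      t * (1 - P * ((1 + η) * a ^ 2 / 2)) ≤ (1 + η) * a ^ 2 / 2 - a * W) :
    W < 3 ∧ -W ^ 2 / 2 - 3 * η < t ∧ t < (max 0 (1 - W) ^ 2 - W ^ 2) / 2 + 6 * η := by
  have hu2 : U ^ 2 ≤ 10 / 9 := by nlinarith [sq_nonneg U]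
  have hu : U ≤ 11 / 10 := by nlinarith
  have hb1 : t ≤ 1 := by
    have h1 := M 1 le_rfl (by norm_num)
    have h2 : P * ((1 + η) * 1 ^ 2 / 2) ≤ 1 / 10 := by nlinarith
    by_contra! hc
    nlinarith
  have hlow : -(12 / 10) * W ≤ t := by
    rcases le_or_gt 0 t with h0 | h0
    · linarith
    · have h1 : t * (1 - P * s) ≤ t * (11 / 12) := by
        apply mul_le_mul_of_nonpos_left _ h0.le
        nlinarith
      have h2 : W * U ≤ W * (11 / 10) := by gcongr
      linarith
  have hw3 : W < 3 := by
    by_contra! hc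
    -- Radius 2 gives roughly `t ≤ 2 - 2 * W`, incompatible with `t ≥ -1.2 * W` once `W ≥ 3`.
    have h1 := M 2 (by norm_num) (by norm_num)
    have hk0 : 0 ≤ P * ((1 + η) * 2 ^ 2 / 2) := by positivity
    have hk1 : P * ((1 + η) * 2 ^ 2 / 2) ≤ 1 := by nlinarith
    set k := P * ((1 + η) * 2 ^ 2 / 2)
    have h2 : t < 0 := by
      by_contra! h0
      have : 0 ≤ t * (1 - k) := mul_nonneg h0 (by linarith)
      linarith
    have h3 : t ≤ t * (1 - k) := by nlinarith
    linarith
  have ht4 : |t| ≤ 4 := by rw [abs_le]; constructor <;> linarith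
  have hcorr : ∀ s', 0 ≤ s' → s' ≤ 9 → |t * (P * s')| ≤ η := by
    intro s' h0 h9
    rw [abs_mul, abs_of_nonneg (by positivity : 0 ≤ P * s')]
    calc |t| * (P * s') ≤ 4 * (P * 9) := by gcongr
      _ ≤ η := by linarith
  refine ⟨hw3, ?_, ?_⟩
  · have h1 := (abs_le.1 (hcorr s hs0 (by linarith))).1
    have h2 := (abs_le.1 (hcorr s hs0 (by linarith))).2
    have h3 : η * U ^ 2 ≤ η * (10 / 9) := by gcongr
    -- `U ^ 2 / 2 - W * U ≥ -W ^ 2 / 2`: every point of the gain lies essentially above the dual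
    -- paraboloid.
    have h4 := sq_nonneg (W - U)
    linarith
  · set a : ℝ := max 1 W
    have ha1 : 1 ≤ a := le_max_left _ _
    have ha3 : a ≤ 3 := max_le (by norm_num) hw3.le
    have h1 := M a ha1 ha3
    have ha9 : a ^ 2 ≤ 9 := by nlinarith
    have h2 := (abs_le.1 (hcorr ((1 + η) * a ^ 2 / 2) (by positivity) (by nlinarith))).2
    have h3 : a ^ 2 / 2 - a * W = (max 0 (1 - W) ^ 2 - W ^ 2) / 2 := by
      rcases le_total W 1 with h | h
      · simp only [a]; rw [max_eq_left h, max_eq_right (by linarith)]; ring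
      · simp only [a]; rw [max_eq_right h, max_eq_left (by linarith)]; ring
    have h4 : η * a ^ 2 ≤ η * 9 := by gcongr
    linarith

/-- One violated inequality, at a point of the cap, and the satisfied ones just below it are
rewritten in parabolic coordinates and fed to `rescaled_gain_bounds`. -/
lemma Osculates.polarGain_subset {A : Set (G × ℝ)} (h : Osculates A) (hA : Convex ℝ A) {η : ℝ}
    (hη : 0 < η) (hη1 : η ≤ 1 / 10) : ∃ ρ₀ > 0, ∀ ρ, 0 < ρ → ρ < ρ₀ → ∀ (w : G) (t : ℝ),
      (ρ • w, 1 + ρ ^ 2 * t) ∈ polarGain A ρ →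
        ‖w‖ < 3 ∧ -‖w‖ ^ 2 / 2 - 3 * η < t ∧
          t < (max 0 (1 - ‖w‖) ^ 2 - ‖w‖ ^ 2) / 2 + 6 * η := by
  obtain ⟨r, hr, H⟩ := h.2 η hη (by linarith)
  obtain ⟨δ, hδ, Hδ⟩ := h.exists_cap_small hA hr
  set m : ℝ := min (min r δ) η
  have hm : 0 < m := by positivity
  have hmr : m ≤ r := (min_le_left _ _).trans (min_le_left _ _)
  have hmδ : m ≤ δ := (min_le_left _ _).trans (min_le_right _ _)
  have hmη : m ≤ η := min_le_right _ _
  refine ⟨m / 36, by positivity, fun ρ hρ hρm w t ⟨⟨q, hq, hq1, hqV⟩, hmem⟩ => ?_⟩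
  have hρ1 : ρ < 1 / 360 := by linarith
  have hP : 0 < ρ ^ 2 := by positivity
  have hPρ : ρ ^ 2 ≤ ρ / 360 := by nlinarith
  have hPm : 36 * ρ ^ 2 ≤ m := by linarith
  have hPη : 36 * ρ ^ 2 ≤ η := hPm.trans hmη
  have hnorm : ∀ u : G, ‖ρ • u‖ = ρ * ‖u‖ := fun u => by
    rw [norm_smul, Real.norm_eq_abs, abs_of_pos hρ]
  have hpair : ∀ (u : G) (s : ℝ), pairing (ρ • w, 1 + ρ ^ 2 * t) (ρ • u, 1 - ρ ^ 2 * s) =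
      1 + ρ ^ 2 * (inner ℝ w u - s + t * (1 - ρ ^ 2 * s)) := by
    intro u s
    simp only [pairing, real_inner_smul_left, real_inner_smul_right]; ring
  -- constraints coming from points of `A` below the cap
  have M : ∀ (u : G) (s : ℝ), ‖u‖ ≤ 4 → (1 + η) * ‖u‖ ^ 2 / 2 ≤ s → 1 / 2 ≤ s → s ≤ 9 →
      t * (1 - ρ ^ 2 * s) ≤ s - inner ℝ w u := by
    intro u s hu hus hs hs9
    have h1 := (H (ρ • u) (ρ ^ 2 * s) (by rw [hnorm]; nlinarith) (by
      rw [abs_of_nonneg (by positivity)]; nlinarith)).2 (by rw [hnorm]; nlinarith)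
    have h2 := hmem _ h1 (by simp only; nlinarith) (by simp only; nlinarith)
    rw [hpair] at h2
    have h3 : inner ℝ w u - s + t * (1 - ρ ^ 2 * s) ≤ 0 := by
      by_contra! hc
      have := mul_pos hP hc
      linarith
    linarith
  -- the violated constraint
  obtain ⟨u, s, rfl⟩ : ∃ (u : G) (s : ℝ), q = (ρ • u, 1 - ρ ^ 2 * s) := by
    refine ⟨ρ⁻¹ • q.1, (1 - q.2) / ρ ^ 2, ?_⟩
    ext
    · simp [smul_smul, hρ.ne']
    · simp only; field_simp; ring
  have hs0 : 0 ≤ s := by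
    have := h.1 _ hq; simp only at this
    by_contra! hc
    nlinarith
  have hs1 : s < 1 / 2 := by
    simp only at hq1
    by_contra! hc
    nlinarith
  have hru : ‖ρ • u‖ < r := Hδ _ _ hq (by nlinarith)
  have hus : (1 - η) * ‖u‖ ^ 2 / 2 ≤ s := by
    have h1 := (H (ρ • u) (ρ ^ 2 * s) hru (by
      rw [abs_of_nonneg (by positivity)]; nlinarith)).1 hq
    rw [hnorm] at h1
    by_contra! hc
    nlinarith
  have V : s - inner ℝ w u < t * (1 - ρ ^ 2 * s) := by
    rw [hpair] at hqV
    by_contra! hc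
    have : ρ ^ 2 * (inner ℝ w u - s + t * (1 - ρ ^ 2 * s)) ≤ 0 :=
      mul_nonpos_of_nonneg_of_nonpos hP.le (by linarith)
    linarith
  have hw0 := norm_nonneg w
  -- test points in the direction of `w`
  have M' : ∀ a : ℝ, 1 ≤ a → a ≤ 3 → t * (1 - ρ ^ 2 * ((1 + η) * a ^ 2 / 2)) ≤
      (1 + η) * a ^ 2 / 2 - a * ‖w‖ := by
    intro a ha ha3
    have hn : ‖(a / ‖w‖) • w‖ ≤ a := by
      rcases hw0.eq_or_lt with h0 | h0
      · rw [norm_smul, ← h0]; simp only [mul_zero]; linarith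
      · rw [norm_smul, Real.norm_eq_abs, abs_of_nonneg (by positivity), div_mul_cancel₀ _ h0.ne']
    have hi : inner ℝ w ((a / ‖w‖) • w) = a * ‖w‖ := by
      rw [real_inner_smul_right, real_inner_self_eq_norm_sq]
      rcases hw0.eq_or_lt with h0 | h0
      · rw [← h0]; ring
      · field_simp
    rw [← hi]
    have hn2 : ‖(a / ‖w‖) • w‖ ^ 2 ≤ a ^ 2 := by
      gcongr
    refine M _ _ (by linarith) (by nlinarith) (by nlinarith) (by nlinarith)
  exact rescaled_gain_bounds hw0 (norm_nonneg u) hs0 hs1 hη hη1 hP hPη hus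
    (lt_of_le_of_lt (sub_le_sub_left (real_inner_le_norm w u) s) V) M'

/-- The linear map `(w, t) ↦ (ρ w, ρ² t)`. -/
noncomputable def parabolicDilation (G : Type*) [NormedAddCommGroup G] [InnerProductSpace ℝ G]
    (ρ : ℝ) : (G × ℝ) →ₗ[ℝ] (G × ℝ) :=
  (ρ • LinearMap.id).prodMap ((ρ ^ 2) • LinearMap.id)

lemma parabolicDilation_apply (ρ : ℝ) (p : G × ℝ) :
    parabolicDilation G ρ p = (ρ • p.1, ρ ^ 2 * p.2) := by
  simp [parabolicDilation]

lemma det_parabolicDilation_ne_zero {ρ : ℝ} (hρ : ρ ≠ 0) :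
    LinearMap.det (parabolicDilation G ρ) ≠ 0 := by
  have h : parabolicDilation G ρ ∘ₗ parabolicDilation G ρ⁻¹ = LinearMap.id := by
    ext p <;> simp [parabolicDilation_apply, smul_smul, hρ]
  have h2 := congrArg LinearMap.det h
  rw [LinearMap.det_comp, LinearMap.det_id] at h2
  exact left_ne_zero_of_mul_eq_one h2

variable [FiniteDimensional ℝ G] [MeasurableSpace G] [BorelSpace G]

/-- Translation and dilation multiply both measures by the same factor, so volumes may be compared
after rescaling. -/
lemma measure_lt_of_preimage_parabolicDilation_lt (μ : Measure (G × ℝ)) [μ.IsAddHaarMeasure]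
    {ρ : ℝ} (hρ : ρ ≠ 0) (e : G × ℝ) {X Y : Set (G × ℝ)}
    (h : μ {p | e + parabolicDilation G ρ p ∈ X} < μ {p | e + parabolicDilation G ρ p ∈ Y}) :
    μ X < μ Y := by
  have key : ∀ Z : Set (G × ℝ), μ {p | e + parabolicDilation G ρ p ∈ Z} =
      ENNReal.ofReal |(LinearMap.det (parabolicDilation G ρ))⁻¹| * μ Z := by
    intro Z
    rw [← measure_preimage_add μ e Z,
      ← Measure.addHaar_preimage_linearMap μ (det_parabolicDilation_ne_zero hρ)]
    rfl
  rw [key, key] at h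
  exact lt_of_mul_lt_mul_left' h

/-- Pointwise `(1 - r)² < 1 - r²` for `0 < r < 1`, with equality at the centre. Nontriviality of `G`
makes the centre a null set; for dimension zero the two sides would agree. -/
lemma lintegral_paraboloid_lt [Nontrivial G] (μ : Measure G) [μ.IsAddHaarMeasure] :
    ∫⁻ w in Metric.ball (0 : G) 3, ENNReal.ofReal (max 0 (1 - ‖w‖) ^ 2 / 2) ∂μ <
      ∫⁻ w in Metric.ball (0 : G) 3, ENNReal.ofReal ((1 - ‖w‖ ^ 2) / 2) ∂μ := by
  refine lintegral_strict_mono_of_ae_le_of_ae_lt_on (s := Metric.ball 0 1 \ {0})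
    (by fun_prop) (setLIntegral_lt_top_of_le_nnreal measure_ball_lt_top.ne
      ⟨1, fun w _ => ?_⟩).ne (Eventually.of_forall fun w => ?_) ?_ ?_
  · rw [ENNReal.coe_one, ENNReal.ofReal_le_one]
    have h1 : max 0 (1 - ‖w‖) ≤ 1 := max_le zero_le_one (by linarith [norm_nonneg w])
    nlinarith [le_max_left 0 (1 - ‖w‖)]
  · rcases le_total ‖w‖ 1 with h | h
    · refine ENNReal.ofReal_le_ofReal ?_
      rw [max_eq_right (by linarith)]
      nlinarith [norm_nonneg w]
    · beta_reduce
      rw [max_eq_left (by linarith)]; simp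
  · rw [Measure.restrict_apply (measurableSet_ball.diff (measurableSet_singleton 0)),
      inter_eq_left.2 (sdiff_subset.trans (Metric.ball_subset_ball (by norm_num))),
      measure_sdiff_null (measure_singleton _)]
    exact (Metric.measure_ball_pos μ 0 one_pos).ne'
  · refine Eventually.of_forall fun w ⟨hw, hw0⟩ => ?_
    rw [mem_ball_zero_iff] at hw
    have h0 : 0 < ‖w‖ := norm_pos_iff.2 hw0
    rw [max_eq_right (by linarith)]
    refine (ENNReal.ofReal_lt_ofReal_iff (by nlinarith)).2 ?_
    nlinarith

/-- The volume gained by the polar is strictly smaller than the volume of a small cap. -/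
lemma Osculates.measure_polarGain_lt [Nontrivial G] (μ : Measure G) [μ.IsAddHaarMeasure]
    {A : Set (G × ℝ)} (h : Osculates A) (hA : Convex ℝ A) : ∃ ρ₀ > 0, ∀ ρ, 0 < ρ → ρ < ρ₀ →
      μ.prod volume (polarGain A ρ) < μ.prod volume (A ∩ {q | 1 - ρ ^ 2 / 2 < q.2}) := by
  have hlt := lintegral_paraboloid_lt (G := G) μ
  set I₁ := ∫⁻ w in Metric.ball (0 : G) 3, ENNReal.ofReal (max 0 (1 - ‖w‖) ^ 2 / 2) ∂μ
  set I₂ := ∫⁻ w in Metric.ball (0 : G) 3, ENNReal.ofReal ((1 - ‖w‖ ^ 2) / 2) ∂μ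
  set V := μ (Metric.ball (0 : G) 3)
  have hV : V ≠ ⊤ := measure_ball_lt_top.ne
  -- The error budget: `3 * η + 6 * η` from the two bounds on the gain and at most `η` from the cap,
  -- all over the ball of radius 3.
  obtain ⟨η, hη0, hη1, hη⟩ : ∃ η : ℝ, 0 < η ∧ η ≤ 1 / 10 ∧
      I₁ + ENNReal.ofReal (10 * η) * V < I₂ := by
    have hlim : Tendsto (fun η : ℝ => I₁ + ENNReal.ofReal (10 * η) * V) (𝓝[>] 0) (𝓝 I₁) := by
      have h1 : Tendsto (fun η : ℝ => I₁ + ENNReal.ofReal (10 * η) * V) (𝓝 0)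
          (𝓝 (I₁ + ENNReal.ofReal (10 * 0) * V)) := by
        refine Tendsto.const_add _ (ENNReal.Tendsto.mul_const (ENNReal.tendsto_ofReal ?_)
          (Or.inr hV))
        have : Continuous fun t : ℝ => 10 * t := by fun_prop
        exact this.tendsto 0
      simp only [mul_zero, ENNReal.ofReal_zero, zero_mul, add_zero] at h1
      exact h1.mono_left nhdsWithin_le_nhds
    have h2 := (hlim.eventually (gt_mem_nhds hlt)).and
      (Ioc_mem_nhdsGT (show (0 : ℝ) < 1 / 10 by norm_num))
    obtain ⟨η, h3, h4⟩ := h2.exists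
    exact ⟨η, h4.1, h4.2, h3⟩
  obtain ⟨ρ₁, hρ₁, H₁⟩ := h.cap_contains hη0 (by linarith)
  obtain ⟨ρ₂, hρ₂, H₂⟩ := h.polarGain_subset hA hη0 hη1
  refine ⟨min ρ₁ ρ₂, by positivity, fun ρ hρ hρ' => ?_⟩
  refine measure_lt_of_preimage_parabolicDilation_lt (μ.prod volume) hρ.ne' ((0 : G), (1 : ℝ)) ?_
  have hform : ∀ p : G × ℝ, ((0 : G), (1 : ℝ)) + parabolicDilation G ρ p =
      (ρ • p.1, 1 + ρ ^ 2 * p.2) := by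
    intro p; rw [parabolicDilation_apply]; simp
  simp only [hform]
  have hgain : μ.prod volume {p : G × ℝ | (ρ • p.1, 1 + ρ ^ 2 * p.2) ∈ polarGain A ρ} ≤
      I₁ + ENNReal.ofReal (9 * η) * V := by
    have hsub : {p : G × ℝ | (ρ • p.1, 1 + ρ ^ 2 * p.2) ∈ polarGain A ρ} ⊆
        regionBetween (fun w => -‖w‖ ^ 2 / 2 - 3 * η)
          (fun w => (max 0 (1 - ‖w‖) ^ 2 - ‖w‖ ^ 2) / 2 + 6 * η) (Metric.ball 0 3) := by
      rintro ⟨w, t⟩ hp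
      obtain ⟨h1, h2, h3⟩ := H₂ ρ hρ (hρ'.trans_le (min_le_right _ _)) w t hp
      exact ⟨mem_ball_zero_iff.2 h1, h2, h3⟩
    refine (measure_mono hsub).trans ?_
    rw [volume_regionBetween_eq_lintegral (by fun_prop) (by fun_prop) measurableSet_ball,
      ← setLIntegral_const, ← lintegral_add_right _ measurable_const]
    refine lintegral_mono fun w => ?_
    rw [← ENNReal.ofReal_add (by positivity) (by positivity)]
    refine ENNReal.ofReal_le_ofReal ?_
    simp only [Pi.sub_apply]
    linarith
  have hcap : I₂ ≤ μ.prod volume {p : G × ℝ | (ρ • p.1, 1 + ρ ^ 2 * p.2) ∈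
      A ∩ {q | 1 - ρ ^ 2 / 2 < q.2}} + ENNReal.ofReal η * V := by
    have hsub : regionBetween (fun _ => -(1 / 2)) (fun u => -‖u‖ ^ 2 / 2 - η / 2)
          (Metric.ball (0 : G) 3) ⊆ {p : G × ℝ | (ρ • p.1, 1 + ρ ^ 2 * p.2) ∈
      A ∩ {q | 1 - ρ ^ 2 / 2 < q.2}} := by
      rintro ⟨u, s⟩ ⟨-, h2, h3⟩
      exact H₁ ρ hρ (hρ'.trans_le (min_le_left _ _)) u s h2 h3
    refine le_trans ?_ (add_le_add_left (measure_mono hsub) _)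
    rw [volume_regionBetween_eq_lintegral (by fun_prop) (by fun_prop) measurableSet_ball,
      ← setLIntegral_const, ← lintegral_add_right _ measurable_const]
    refine lintegral_mono fun w => ?_
    refine le_trans (ENNReal.ofReal_le_ofReal ?_) ENNReal.ofReal_add_le
    simp only [Pi.sub_apply]
    linarith
  have hsum : ENNReal.ofReal (9 * η) * V + ENNReal.ofReal η * V = ENNReal.ofReal (10 * η) * V := by
    rw [← add_mul, ← ENNReal.ofReal_add (by positivity) hη0.le]; ring_nf
  refine lt_of_add_lt_add_right (a := ENNReal.ofReal η * V) ?_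
  calc _ ≤ I₁ + ENNReal.ofReal (9 * η) * V + ENNReal.ofReal η * V := by gcongr
    _ = I₁ + ENNReal.ofReal (10 * η) * V := by rw [add_assoc, hsum]
    _ < I₂ := hη
    _ ≤ _ := hcap

end Volume

/-! ### Cutting a cap lowers the volume product. -/

/-- `(A - a) * (D + b) = A * D + (A * b - a * D) - a * b`, and `A * b < a * D` because `A ≤ D` and
`b < a`. -/
lemma ENNReal.mul_lt_mul_of_loss_gt_gain {A D L P a b : ENNReal} (hA : A ≠ ⊤) (hD : D ≠ ⊤)
    (hL : L + a ≤ A) (hP : P ≤ D + b) (hba : b < a) (hAD : A ≤ D) : L * P < A * D := by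
  have ha : a ≠ ⊤ := ne_top_of_le_ne_top hA (le_add_self.trans hL)
  have hL' : L ≠ ⊤ := ne_top_of_le_ne_top hA (le_self_add.trans hL)
  have hb : b ≠ ⊤ := hba.ne_top
  have hP' : P ≠ ⊤ := ne_top_of_le_ne_top (ENNReal.add_ne_top.2 ⟨hD, hb⟩) hP
  lift A to NNReal using hA
  lift D to NNReal using hD
  lift L to NNReal using hL'
  lift P to NNReal using hP'
  lift a to NNReal using ha
  lift b to NNReal using hb
  norm_cast at *
  rw [← NNReal.coe_lt_coe]
  push_cast
  have h1 : (L : ℝ) + a ≤ A := by exact_mod_cast hL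
  have h2 : (P : ℝ) ≤ D + b := by exact_mod_cast hP
  have h3 : (b : ℝ) < a := by exact_mod_cast hba
  have h4 : (A : ℝ) ≤ D := by exact_mod_cast hAD
  have h5 : (0 : ℝ) ≤ L := L.2
  have h6 : (0 : ℝ) ≤ b := b.2
  have hD0 : (0 : ℝ) < D := by linarith
  calc (L : ℝ) * P ≤ (A - a) * (D + b) := by
        apply mul_le_mul (by linarith) h2 P.2 (by linarith)
    _ < A * D := by nlinarith

lemma addHaar_neg {V : Type*} [NormedAddCommGroup V] [NormedSpace ℝ V] [FiniteDimensional ℝ V]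
    [MeasurableSpace V] [BorelSpace V] (μ : Measure V) [μ.IsAddHaarMeasure] (s : Set V) :
    μ (-s) = μ s := by
  simp

section Cut

variable {G : Type*} [NormedAddCommGroup G] [InnerProductSpace ℝ G]

lemma zero_mem_interior_of_smul_mem {V : Type*} [NormedAddCommGroup V] [NormedSpace ℝ V]
    {A L : Set V} (h0 : 0 ∈ interior A) {c : ℝ} (hc : 0 < c) (h : ∀ q ∈ A, c • q ∈ L) :
    0 ∈ interior L := by
  rw [mem_interior_iff_mem_nhds] at h0 ⊢
  have hcont : Tendsto (fun q : V => c⁻¹ • q) (𝓝 0) (𝓝 0) := by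
    have : Continuous fun q : V => c⁻¹ • q := by fun_prop
    simpa using this.tendsto 0
  filter_upwards [hcont h0] with q hq
  have := h _ hq
  rwa [smul_inv_smul₀ hc.ne'] at this

lemma neg_mem_pairingPolar {A : Set (G × ℝ)} (h : ∀ q ∈ A, -q ∈ A) :
    ∀ p ∈ pairingPolar A, -p ∈ pairingPolar A := by
  intro p hp q hq
  rw [pairing_neg_left, ← pairing_neg_right]
  exact hp _ (h q hq)

lemma smul_mem_pairingPolar {A L : Set (G × ℝ)} {c : ℝ} (h : ∀ q ∈ L, c • q ∈ A) :
    ∀ p ∈ pairingPolar A, c • p ∈ pairingPolar L := by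
  intro p hp q hq
  rw [pairing_smul_left, ← pairing_smul_right]
  exact hp _ (h q hq)

variable [FiniteDimensional ℝ G] [MeasurableSpace G] [BorelSpace G] [Nontrivial G]

/-- Cutting off a small cap decreases the volume product if the volume of the body is at most
the volume of its polar. -/
lemma Osculates.exists_cut (μ : Measure G) [μ.IsAddHaarMeasure] {A : Set (G × ℝ)}
    (h : Osculates A) (hA : Convex ℝ A) (hAc : IsCompact A) (h0 : 0 ∈ interior A)
    (hle : μ.prod volume A ≤ μ.prod volume (pairingPolar A)) {δ : ℝ} (hδ : 0 < δ) (hδ1 : δ < 1) :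
    ∃ L : Set (G × ℝ), IsCompact L ∧ Convex ℝ L ∧ L ⊆ A ∧ (∀ q ∈ A, (1 - δ) • q ∈ L) ∧
      ((∀ q ∈ A, -q ∈ A) → ∀ q ∈ L, -q ∈ L) ∧
      μ.prod volume L * μ.prod volume (pairingPolar L) <
        μ.prod volume A * μ.prod volume (pairingPolar A) := by
  obtain ⟨ρ₀, hρ₀, H⟩ := h.measure_polarGain_lt μ hA
  set ρ : ℝ := min ρ₀ δ / 2
  have hρ : 0 < ρ := by positivity
  have hρρ₀ : ρ < ρ₀ := by have := min_le_left ρ₀ δ; simp only [ρ]; linarith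
  have hρδ : ρ < δ := by have := min_le_right ρ₀ δ; simp only [ρ]; linarith
  have hlt := H ρ hρ hρρ₀
  set d : ℝ := ρ ^ 2 / 2
  have hdef : d = ρ ^ 2 / 2 := rfl
  have hd : 0 < d := by positivity
  have hdδ : d < δ := by simp only [d]; nlinarith
  have hd2 : d < 1 / 2 := by simp only [d]; nlinarith
  set gain := polarGain A ρ
  set cap := A ∩ {q : G × ℝ | 1 - d < q.2}
  have h0A : (0 : G × ℝ) ∈ A := interior_subset h0
  have hmeasA : MeasurableSet A := hAc.isClosed.measurableSet
  have hmeascap : MeasurableSet cap :=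
    hmeasA.inter (isOpen_lt continuous_const continuous_snd).measurableSet
  have hfinA : μ.prod volume A ≠ ⊤ := hAc.measure_lt_top.ne
  have hfinD : μ.prod volume (pairingPolar A) ≠ ⊤ := (isCompact_pairingPolar h0).measure_lt_top.ne
  have hshrink : ∀ q ∈ A, (1 - δ) • q ∈ A := fun q hq => by
    have := hA hq h0A (sub_nonneg.2 hδ1.le) hδ.le (by ring)
    simpa using this
  have hsmall : ∀ x : ℝ, x ≤ 1 → (1 - δ) * x ≤ 1 - d := fun x hx => by nlinarith
  -- A symmetric body loses both opposite caps, so that the result stays symmetric; loss and gain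
  -- are both doubled.
  by_cases hsym : ∀ q ∈ A, -q ∈ A
  · have hsnd : ∀ q ∈ A, -1 ≤ q.2 := fun q hq => by
      have := h.1 _ (hsym q hq); simp only [Prod.snd_neg] at this; linarith
    refine ⟨A ∩ {q | -(1 - d) ≤ q.2 ∧ q.2 ≤ 1 - d}, ?_, ?_, inter_subset_left, ?_, ?_, ?_⟩
    · refine hAc.inter_right ?_
      exact (isClosed_le continuous_const continuous_snd).inter
        (isClosed_le continuous_snd continuous_const)
    · refine hA.inter ?_
      exact (convex_Icc (-(1 - d)) (1 - d)).linear_preimage (LinearMap.snd ℝ G ℝ)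
    · refine fun q hq => ⟨hshrink q hq, ?_, ?_⟩
      · have := hsmall (-q.2) (by linarith [hsnd q hq])
        simp only [Prod.smul_snd, smul_eq_mul]; linarith
      · exact hsmall q.2 (h.1 q hq)
    · rintro - q ⟨hq, h1, h2⟩
      exact ⟨hsym q hq, by simp only [Prod.snd_neg]; linarith,
        by simp only [Prod.snd_neg]; linarith⟩
    · refine ENNReal.mul_lt_mul_of_loss_gt_gain (a := μ.prod volume cap + μ.prod volume (-cap))
        (b := μ.prod volume gain + μ.prod volume (-gain)) hfinA hfinD ?_ ?_ ?_ hle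
      · have hd1 : Disjoint cap (-cap) := by
          refine Set.disjoint_left.2 fun q hq hq' => ?_
          have e1 := hq.2
          have e2 := hq'.2
          simp only [mem_ofPred_eq, Prod.snd_neg] at e1 e2
          linarith
        have hd2 : Disjoint (A ∩ {q | -(1 - d) ≤ q.2 ∧ q.2 ≤ 1 - d}) (cap ∪ -cap) := by
          refine Set.disjoint_left.2 ?_
          rintro q ⟨-, e1, e2⟩ (⟨-, hq⟩ | ⟨-, hq⟩)
          · simp only [mem_ofPred_eq] at hq; linarith
          · simp only [mem_ofPred_eq, Prod.snd_neg] at hq; linarith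
        rw [← measure_union hd1 hmeascap.neg, ← measure_union hd2 (hmeascap.union hmeascap.neg)]
        refine measure_mono (union_subset inter_subset_left (union_subset inter_subset_left ?_))
        intro q hq
        have := hsym _ hq.1
        rwa [neg_neg] at this
      · refine le_trans (measure_mono (t := pairingPolar A ∪ (gain ∪ -gain)) ?_)
          ((measure_union_le _ _).trans (add_le_add_right (measure_union_le _ _) _))
        intro p hp
        by_contra hc
        simp only [mem_union, not_or] at hc
        obtain ⟨hpA, hpg, hpg'⟩ := hc
        refine hpA fun q hq => ?_
        by_contra! hpq
        rcases lt_or_ge (1 - d) q.2 with h1 | h1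
        -- The restriction `1 / 2 ≤ q.2` in `polarGain` matters here: it keeps the test points out
        -- of the opposite cap, so they belong to the cut body.
        · exact hpg ⟨⟨q, hq, h1, hpq⟩, fun q' hq' e1 e2 => hp q' ⟨hq', by linarith, e2⟩⟩
        rcases lt_or_ge q.2 (-(1 - d)) with h2 | h2
        · refine hpg' ⟨⟨-q, hsym q hq, by simp only [Prod.snd_neg]; linarith [hdef], ?_⟩,
            fun q' hq' e1 e2 => ?_⟩
          · rwa [pairing_neg_left, pairing_neg_right, neg_neg]
          · rw [pairing_neg_left, ← pairing_neg_right]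
            exact hp _ ⟨hsym q' hq', by simp only [Prod.snd_neg]; linarith [hdef],
              by simp only [Prod.snd_neg]; linarith⟩
        · exact absurd (hp q ⟨hq, h2, h1⟩) (not_le.2 hpq)
      · rw [addHaar_neg, addHaar_neg]
        exact ENNReal.add_lt_add hlt hlt
  · refine ⟨A ∩ {q | q.2 ≤ 1 - d}, ?_, ?_, inter_subset_left, ?_, fun hs => absurd hs hsym, ?_⟩
    · exact hAc.inter_right (isClosed_le continuous_snd continuous_const)
    · refine hA.inter ?_
      exact (convex_Iic (1 - d)).linear_preimage (LinearMap.snd ℝ G ℝ)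
    · exact fun q hq => ⟨hshrink q hq, hsmall q.2 (h.1 q hq)⟩
    · refine ENNReal.mul_lt_mul_of_loss_gt_gain (a := μ.prod volume cap)
        (b := μ.prod volume gain) hfinA hfinD ?_ ?_ hlt hle
      · have hd2 : Disjoint (A ∩ {q | q.2 ≤ 1 - d}) cap := by
          refine Set.disjoint_left.2 ?_
          rintro q ⟨-, e1⟩ ⟨-, hq⟩
          simp only [mem_ofPred_eq] at hq e1; linarith
        rw [← measure_union hd2 hmeascap]
        exact measure_mono (union_subset inter_subset_left inter_subset_left)
      · refine le_trans (measure_mono (t := pairingPolar A ∪ gain) ?_) (measure_union_le _ _)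
        intro p hp
        by_contra hc
        simp only [mem_union, not_or] at hc
        obtain ⟨hpA, hpg⟩ := hc
        refine hpA fun q hq => ?_
        by_contra! hpq
        rcases lt_or_ge (1 - d) q.2 with h1 | h1
        · exact hpg ⟨⟨q, hq, h1, hpq⟩, fun q' hq' e1 e2 => hp q' ⟨hq', e2⟩⟩
        · exact absurd (hp q ⟨hq, h1⟩) (not_le.2 hpq)

/-- Arbitrarily close to an osculating body there is a body with smaller volume product. -/
theorem Osculates.exists_volume_product_lt (μ : Measure G) [μ.IsAddHaarMeasure] {A : Set (G × ℝ)}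
    (h : Osculates A) (hA : Convex ℝ A) (hAc : IsCompact A) (h0 : 0 ∈ interior A)
    {δ : ℝ} (hδ : 0 < δ) (hδ1 : δ < 1) :
    ∃ L : Set (G × ℝ), IsCompact L ∧ Convex ℝ L ∧ 0 ∈ interior L ∧ (∀ q ∈ A, (1 - δ) • q ∈ L) ∧
      (∀ q ∈ L, (1 - δ) • q ∈ A) ∧ ((∀ q ∈ A, -q ∈ A) → ∀ q ∈ L, -q ∈ L) ∧
      μ.prod volume L * μ.prod volume (pairingPolar L) <
        μ.prod volume A * μ.prod volume (pairingPolar A) := by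
  have hshrink : ∀ B : Set (G × ℝ), Convex ℝ B → 0 ∈ B → ∀ q ∈ B, (1 - δ) • q ∈ B :=
    fun B hB h0B q hq => by
      simpa using hB hq h0B (sub_nonneg.2 hδ1.le) hδ.le (by ring)
  have hc : 0 < 1 - δ := by linarith
  rcases le_total (μ.prod volume A) (μ.prod volume (pairingPolar A)) with hle | hle
  · obtain ⟨L, hLc, hL, hLA, hAL, hsym, hlt⟩ := h.exists_cut μ hA hAc h0 hle hδ hδ1
    exact ⟨L, hLc, hL, zero_mem_interior_of_smul_mem h0 hc hAL, hAL,
      fun q hq => hshrink A hA (interior_subset h0) q (hLA hq), hsym, hlt⟩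
  -- The polar is the smaller of the two bodies here, so the cap is cut from it and the polar of the
  -- result is taken.
  · have hbi := pairingPolar_pairingPolar hA hAc.isClosed (interior_subset h0)
    have h0' := zero_mem_interior_pairingPolar hAc.isBounded
    obtain ⟨L, hLc, hL, hLA, hAL, hsym, hlt⟩ :=
      (h.polar hA hAc.isBounded).exists_cut μ (convex_pairingPolar A)
        (isCompact_pairingPolar h0) h0' (by rwa [hbi]) hδ hδ1
    have h0L := zero_mem_interior_of_smul_mem h0' hc hAL
    refine ⟨pairingPolar L, isCompact_pairingPolar h0L, convex_pairingPolar L,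
      zero_mem_interior_pairingPolar hLc.isBounded, ?_, ?_, ?_, ?_⟩
    · intro q hq
      refine hshrink _ (convex_pairingPolar L)
        (interior_subset (zero_mem_interior_pairingPolar hLc.isBounded)) q ?_
      exact pairingPolar_anti hLA (by rwa [hbi])
    · intro q hq
      rw [← hbi]
      exact smul_mem_pairingPolar hAL q hq
    · intro hs
      exact neg_mem_pairingPolar (hsym (neg_mem_pairingPolar hs))
    · rw [hbi] at hlt
      rw [pairingPolar_pairingPolar hL hLc.isClosed (interior_subset h0L), mul_comm]
      rwa [mul_comm (μ.prod volume A)]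

end Cut

/-! ### Second-order expansion of convex functions and the generalized Hessian. -/

section Curvature

variable {F : Type*} [NormedAddCommGroup F] [InnerProductSpace ℝ F]

/-- A convex function on an open set has a subgradient at every point. -/
lemma exists_isSubdifferentialAt [FiniteDimensional ℝ F] {U : Set F} {f : F → ℝ} (hU : IsOpen U)
    (hf : ConvexOn ℝ U f) {x : F} (hx : x ∈ U) : ∃ v, IsSubdifferentialAt f U x v := by
  have : CompleteSpace F := FiniteDimensional.complete ℝ F
  have hcont : ContinuousOn f U := hf.continuousOn hU
  have hopen : IsOpen {p : F × ℝ | p.1 ∈ U ∧ f p.1 < p.2} := by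
    have h1 : IsOpen (Prod.fst ⁻¹' U : Set (F × ℝ)) := hU.preimage continuous_fst
    have h2 : ContinuousOn (fun p : F × ℝ => p.2 - f p.1) (Prod.fst ⁻¹' U) :=
      continuous_snd.continuousOn.sub (hcont.comp continuous_fst.continuousOn fun p hp => hp)
    convert h2.isOpen_inter_preimage h1 (isOpen_Ioi (a := (0 : ℝ))) using 1
    ext p; simp
  obtain ⟨g, hg⟩ := geometric_hahn_banach_open_point hf.convex_strict_epigraph hopen
    (x := (x, f x)) (by simp)
  set l : StrongDual ℝ F := g.comp (ContinuousLinearMap.inl ℝ F ℝ)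
  set c : ℝ := -g (0, 1)
  have hgp : ∀ p : F × ℝ, g p = l p.1 - c * p.2 := by
    intro p
    have hp : p = (p.1, 0) + p.2 • ((0 : F), (1 : ℝ)) := by ext <;> simp
    conv_lhs => rw [hp, map_add, map_smul]
    simp only [l, c, ContinuousLinearMap.comp_apply, ContinuousLinearMap.inl_apply, smul_eq_mul]
    ring
  have hc : 0 < c := by
    have := hg (x, f x + 1) ⟨hx, by simp⟩
    rw [hgp, hgp] at this
    simp only at this
    linarith
  refine ⟨c⁻¹ • (InnerProductSpace.toDual ℝ F).symm l, fun y hy => ?_⟩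
  rw [real_inner_smul_left, InnerProductSpace.toDual_symm_apply, map_sub]
  refine le_of_forall_gt_imp_ge_of_dense fun t ht => ?_
  have h1 := hg (y, t) ⟨hy, ht⟩
  rw [hgp, hgp] at h1
  simp only at h1
  have h2 : c⁻¹ * (l y - l x) ≤ t - f x := by
    rw [inv_mul_le_iff₀ hc]; linarith
  linarith

/-- Over `k + 1` equal steps the quadratic errors add up to `C / (k + 1)`, which tends to 0. This
replaces integration of a derivative. -/
lemma le_of_sub_le_sq {ψ : ℝ → ℝ} {C : ℝ}
    (h : ∀ a b, 0 ≤ a → a ≤ b → b ≤ 1 → ψ b - ψ a ≤ C * (b - a) ^ 2) : ψ 1 ≤ ψ 0 := by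
  have key : ∀ k : ℕ, ψ 1 ≤ ψ 0 + C * (1 / ((k : ℝ) + 1)) := by
    intro k
    have hk : (0 : ℝ) < (k : ℝ) + 1 := by positivity
    have hi : ∀ i : ℕ, i ≤ k + 1 →
        ψ ((i : ℝ) / (k + 1)) ≤ ψ 0 + i * (C * (1 / ((k : ℝ) + 1)) ^ 2) := by
      intro i
      induction i with
      | zero => intro _; simp
      | succ i ih =>
        intro hik
        have h1 := ih (by omega)
        have h2 := h ((i : ℝ) / (k + 1)) (((i + 1 : ℕ) : ℝ) / (k + 1)) (by positivity)
          (by gcongr; simp) (by rw [div_le_one hk]; exact_mod_cast hik)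
        have h3 : ((i + 1 : ℕ) : ℝ) / (k + 1) - (i : ℝ) / (k + 1) = 1 / ((k : ℝ) + 1) := by
          push_cast; ring
        rw [h3] at h2
        push_cast at h2 ⊢
        linarith
    have h1 := hi (k + 1) le_rfl
    push_cast at h1
    rw [div_self hk.ne'] at h1
    have h2 : ((k : ℝ) + 1) * (C * (1 / ((k : ℝ) + 1)) ^ 2) = C * (1 / ((k : ℝ) + 1)) := by
      field_simp
    linarith
  have hlim : Tendsto (fun k : ℕ => ψ 0 + C * (1 / ((k : ℝ) + 1))) atTop (𝓝 (ψ 0 + C * 0)) :=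
    (tendsto_one_div_add_atTop_nhds_zero_nat.const_mul C).const_add _
  have := ge_of_tendsto' hlim key
  simpa using this

/-- A linear function of `t` plus a quadratic one which is nonnegative has vanishing linear
coefficient. -/
lemma eq_zero_of_linear_add_sq_nonneg {a b : ℝ} (h : ∀ t : ℝ, 0 ≤ t * a + t ^ 2 * b) : a = 0 := by
  by_contra ha
  have h1 := h (-a / (2 * (|b| + 1)) )
  have hb : 0 < |b| + 1 := by positivity
  have h2 : -a / (2 * (|b| + 1)) * a + (-a / (2 * (|b| + 1))) ^ 2 * b =
      a ^ 2 * (b - 2 * (|b| + 1)) / (4 * (|b| + 1) ^ 2) := by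
    field_simp; ring
  rw [h2] at h1
  have h3 : a ^ 2 * (b - 2 * (|b| + 1)) / (4 * (|b| + 1) ^ 2) < 0 := by
    apply div_neg_of_neg_of_pos _ (by positivity)
    apply mul_neg_of_pos_of_neg (by positivity)
    linarith [le_abs_self b]
  linarith

lemma tendsto_smul_nhdsGT_zero (u : F) : Tendsto (fun t : ℝ => t • u) (𝓝[>] 0) (𝓝 0) := by
  have : Continuous fun t : ℝ => t • u := by fun_prop
  simpa using (this.tendsto 0).mono_left nhdsWithin_le_nhds

section Hessian

variable {U : Set F} {f : F → ℝ} {A : F →ₗ[ℝ] F}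

lemma HasGeneralizedHessianAt.eventually_norm_sub_le (h : HasGeneralizedHessianAt f U 0 A)
    (h0 : IsSubdifferentialAt f U 0 0) {ε : ℝ} (hε : 0 < ε) :
    ∀ᶠ u in 𝓝 (0 : F), ∀ v, IsSubdifferentialAt f U u v → ‖v - A u‖ ≤ ε * ‖u‖ := by
  obtain ⟨V, hV, -, Θ, hmono, hlim, H⟩ := h
  obtain ⟨r, hr, hΘ⟩ := mem_nhdsGT_iff_exists_Ioc_subset.1 (hlim.eventually (gt_mem_nhds hε))
  filter_upwards [hV, Metric.ball_mem_nhds (0 : F) hr] with u hu hur v hv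
  rw [mem_ball_zero_iff] at hur
  have h1 := H u hu v 0 hv h0
  simp only [sub_zero] at h1
  rcases (norm_nonneg u).eq_or_lt with hu0 | hu0
  · rw [← hu0] at h1 ⊢; simpa using h1
  · exact h1.trans (mul_le_mul_of_nonneg_right (hΘ ⟨hu0, hur.le⟩).le hu0.le)

variable [FiniteDimensional ℝ F]

/-- Subgradients at `t • u` differ from `t • A u` by at most `ε * ‖u‖`; summing the resulting
increments of `f` along the segment from `0` to `u` gives the quadratic expansion. -/
lemma HasGeneralizedHessianAt.eventually_abs_sub_le (h : HasGeneralizedHessianAt f U 0 A)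
    (hU : IsOpen U) (hU0 : 0 ∈ U) (hf : ConvexOn ℝ U f) (hf0 : f 0 = 0)
    (h0 : IsSubdifferentialAt f U 0 0) {ε : ℝ} (hε : 0 < ε) :
    ∀ᶠ u in 𝓝 (0 : F), |f u - inner ℝ (A u) u / 2| ≤ ε * ‖u‖ ^ 2 := by
  obtain ⟨r, hr, H⟩ := Metric.eventually_nhds_iff_ball.1
    ((h.eventually_norm_sub_le h0 hε).and (hU.mem_nhds hU0))
  filter_upwards [Metric.ball_mem_nhds (0 : F) hr] with u hu
  rw [mem_ball_zero_iff] at hu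
  have hmem : ∀ t : ℝ, 0 ≤ t → t ≤ 1 → t • u ∈ Metric.ball (0 : F) r := by
    intro t ht ht1
    rw [mem_ball_zero_iff, norm_smul, Real.norm_eq_abs, abs_of_nonneg ht]
    nlinarith [norm_nonneg u]
  -- one-sided slopes of `f` along the segment from `0` to `u`
  have hslope : ∀ a b : ℝ, 0 ≤ a → a ≤ 1 → 0 ≤ b → b ≤ 1 →
      (b - a) * (a * inner ℝ (A u) u) - |b - a| * (ε * ‖u‖ ^ 2) ≤ f (b • u) - f (a • u) := by
    intro a b ha ha1 hb hb1
    obtain ⟨v, hv⟩ := exists_isSubdifferentialAt hU hf (H _ (hmem a ha ha1)).2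
    have h1 := hv _ (H _ (hmem b hb hb1)).2
    have h2 := (H _ (hmem a ha ha1)).1 v hv
    rw [← sub_smul, real_inner_smul_right] at h1
    have h3 : ‖v - A (a • u)‖ ≤ ε * ‖u‖ := by
      refine h2.trans ?_
      rw [norm_smul, Real.norm_eq_abs, abs_of_nonneg ha]
      have := mul_nonneg hε.le (norm_nonneg u)
      nlinarith
    have h4 : |inner ℝ (v - A (a • u)) u| ≤ ε * ‖u‖ ^ 2 := by
      refine (abs_real_inner_le_norm _ _).trans ?_
      have := mul_le_mul_of_nonneg_right h3 (norm_nonneg u)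
      linarith
    have h5 : inner ℝ v u = inner ℝ (v - A (a • u)) u + a * inner ℝ (A u) u := by
      rw [inner_sub_left, map_smul, real_inner_smul_left]; ring
    have h6 : -(|b - a| * (ε * ‖u‖ ^ 2)) ≤ (b - a) * inner ℝ (v - A (a • u)) u := by
      have := neg_abs_le ((b - a) * inner ℝ (v - A (a • u)) u)
      rw [abs_mul] at this
      have := mul_le_mul_of_nonneg_left h4 (abs_nonneg (b - a))
      linarith
    rw [h5] at h1
    linarith
  set c : ℝ := inner ℝ (A u) u
  set e : ℝ := ε * ‖u‖ ^ 2
  rw [abs_le]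
  constructor
  · have := le_of_sub_le_sq (ψ := fun t => t ^ 2 * (c / 2) - t * e - f (t • u)) (C := c / 2) (by
      intro a b ha hab hb
      have := hslope a b ha (hab.trans hb) (ha.trans hab) hb
      rw [abs_of_nonneg (sub_nonneg.2 hab)] at this
      linarith)
    simp only [one_smul, zero_smul, hf0] at this
    linarith
  · have := le_of_sub_le_sq (ψ := fun t => f (t • u) - t ^ 2 * (c / 2) - t * e) (C := c / 2) (by
      intro a b ha hab hb
      have := hslope b a (ha.trans hab) hb ha (hab.trans hb)
      rw [abs_sub_comm, abs_of_nonneg (sub_nonneg.2 hab)] at this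
      linarith)
    simp only [one_smul, zero_smul, hf0] at this
    linarith

lemma HasGeneralizedHessianAt.inner_self_nonneg (h : HasGeneralizedHessianAt f U 0 A)
    (hU : IsOpen U) (hU0 : 0 ∈ U) (hf : ConvexOn ℝ U f) (hf0 : f 0 = 0)
    (h0 : IsSubdifferentialAt f U 0 0) (u : F) : 0 ≤ inner ℝ (A u) u := by
  refine le_of_forall_pos_le_add fun ε hε => ?_
  set η : ℝ := ε / (2 * (‖u‖ ^ 2 + 1))
  have hη : 0 < η := by positivity
  obtain ⟨t, ⟨ht, htU⟩, ht0⟩ := (((tendsto_smul_nhdsGT_zero u).eventually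
    ((h.eventually_abs_sub_le hU hU0 hf hf0 h0 hη).and (hU.mem_nhds hU0))).and
      self_mem_nhdsWithin).exists
  have ht0 : 0 < t := ht0
  have hpos := h0 _ htU
  rw [hf0, inner_zero_left] at hpos
  rw [map_smul, real_inner_smul_left, real_inner_smul_right, norm_smul, Real.norm_eq_abs,
    abs_of_pos ht0] at ht
  have h1 := (abs_le.1 ht).2
  have h2 : 0 ≤ t ^ 2 * (inner ℝ (A u) u / 2 + η * ‖u‖ ^ 2) := by linarith
  have h3 := nonneg_of_mul_nonneg_right h2 (by positivity)
  have h4 : η * (2 * (‖u‖ ^ 2 + 1)) = ε := by simp only [η]; field_simp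
  linarith

/-- The generalized Hessian of a convex function is symmetric. -/
lemma HasGeneralizedHessianAt.isSymmetric (h : HasGeneralizedHessianAt f U 0 A)
    (hU : IsOpen U) (hU0 : 0 ∈ U) (hf : ConvexOn ℝ U f) (hf0 : f 0 = 0)
    (h0 : IsSubdifferentialAt f U 0 0) : A.IsSymmetric := by
  -- The subgradient inequality from `t • u` to `t • (u + w)`, divided by `t ^ 2`, shows that `A u`
  -- is a subgradient at `u` of the form `⟪A u, u⟫ / 2`. Its gradient is the symmetric part of `A`
  -- applied to `u`, so `A` is symmetric.
  have hsub : ∀ u w : F, inner ℝ (A u) u / 2 + inner ℝ (A u) w ≤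
      inner ℝ (A (u + w)) (u + w) / 2 := by
    intro u w
    refine le_of_forall_pos_le_add fun ε hε => ?_
    set D : ℝ := ‖u + w‖ ^ 2 + ‖u‖ ^ 2 + ‖u‖ * ‖w‖ + 1
    have hD : 0 < D := by positivity
    set η : ℝ := ε / D
    have hη : 0 < η := by positivity
    have hev := (h.eventually_abs_sub_le hU hU0 hf hf0 h0 hη).and
      ((hU.eventually_mem hU0).and (h.eventually_norm_sub_le h0 hη))
    obtain ⟨t, ⟨⟨ht, htU, htv⟩, ht', htU', -⟩, ht0⟩ :=
      (((tendsto_smul_nhdsGT_zero u).eventually hev).and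
        ((tendsto_smul_nhdsGT_zero (u + w)).eventually hev) |>.and self_mem_nhdsWithin).exists
    have ht0 : 0 < t := ht0
    obtain ⟨v, hv⟩ := exists_isSubdifferentialAt hU hf htU
    have h1 := hv _ htU'
    have h2 := htv v hv
    rw [map_smul, real_inner_smul_left, real_inner_smul_right, norm_smul, Real.norm_eq_abs,
      abs_of_pos ht0] at ht ht'
    rw [norm_smul, Real.norm_eq_abs, abs_of_pos ht0] at h2
    rw [← smul_sub, add_sub_cancel_left, real_inner_smul_right] at h1
    have h3 : -(η * (t * ‖u‖) * ‖w‖) ≤ inner ℝ (v - A (t • u)) w := by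
      have e1 := (abs_le.1 (abs_real_inner_le_norm (v - A (t • u)) w)).1
      have e2 := mul_le_mul_of_nonneg_right h2 (norm_nonneg w)
      linarith
    have h4 : inner ℝ v w = inner ℝ (v - A (t • u)) w + t * inner ℝ (A u) w := by
      rw [inner_sub_left, map_smul, real_inner_smul_left]; ring
    have h5 := (abs_le.1 ht).1
    have h6 := (abs_le.1 ht').2
    have h7 := mul_le_mul_of_nonneg_left h3 ht0.le
    rw [h4] at h1
    have h8 : 0 ≤ t ^ 2 * (inner ℝ (A (u + w)) (u + w) / 2 + η * (‖u + w‖ ^ 2 + ‖u‖ ^ 2 + ‖u‖ * ‖w‖)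
        - (inner ℝ (A u) u / 2 + inner ℝ (A u) w)) := by linarith
    have h9 := nonneg_of_mul_nonneg_right h8 (by positivity)
    have h10 : η * D = ε := by simp only [η]; field_simp
    simp only [D] at h10
    linarith
  intro u w
  have : inner ℝ (A w) u - inner ℝ (A u) w = 0 := by
    refine eq_zero_of_linear_add_sq_nonneg (b := inner ℝ (A w) w) fun t => ?_
    have := hsub u (t • w)
    simp only [map_add, map_smul, inner_add_left, inner_add_right, real_inner_smul_left,
      real_inner_smul_right] at this
    linarith
  rw [real_inner_comm (A w) u]
  linarith

lemma HasGeneralizedHessianAt.inner_self_pos (h : HasGeneralizedHessianAt f U 0 A)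
    (hU : IsOpen U) (hU0 : 0 ∈ U) (hf : ConvexOn ℝ U f) (hf0 : f 0 = 0)
    (h0 : IsSubdifferentialAt f U 0 0) (hdet : LinearMap.det A ≠ 0) {u : F} (hu : u ≠ 0) :
    0 < inner ℝ (A u) u := by
  have hnn := h.inner_self_nonneg hU hU0 hf hf0 h0
  have hs := h.isSymmetric hU hU0 hf hf0 h0
  refine lt_of_le_of_ne (hnn u) fun heq => hu ?_
  have hAu : inner ℝ (A u) (A u) = 0 := by
    have : 2 * inner ℝ (A u) (A u) = 0 := by
      -- If the form vanishes at `u`, its nonnegativity along `u + t • A u` leaves no linear term,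
      -- so `A u = 0`.
      refine eq_zero_of_linear_add_sq_nonneg (b := inner ℝ (A (A u)) (A u)) fun t => ?_
      have h1 := hnn (u + t • A u)
      simp only [map_add, map_smul, inner_add_left, inner_add_right, real_inner_smul_left,
        real_inner_smul_right] at h1
      rw [← heq, hs (A u) u] at h1
      linarith
    linarith
  have hA0 : A u = 0 := inner_self_eq_zero.1 hAu
  have hinj : Function.Injective A := by
    rw [← LinearMap.ker_eq_bot]
    by_contra hk
    exact hdet (LinearMap.det_eq_zero_iff_ker_ne_bot.2 hk)
  exact hinj (by rw [hA0, map_zero])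

end Hessian

/-- A positive definite symmetric form is the square of a Euclidean norm. -/
lemma exists_linearEquiv_norm_sq_eq [FiniteDimensional ℝ F] {A : F →ₗ[ℝ] F} (hs : A.IsSymmetric)
    (hpos : ∀ u, u ≠ 0 → 0 < inner ℝ (A u) u) {c : ℝ} (hc : 0 < c) :
    ∃ B : F ≃ₗ[ℝ] EuclideanSpace ℝ (Fin (Module.finrank ℝ F)),
      ∀ u, ‖B u‖ ^ 2 = c * inner ℝ (A u) u := by
  set b := hs.eigenvectorBasis rfl
  set l := hs.eigenvalues rfl
  have hl : ∀ i, 0 ≤ l i := by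
    intro i
    have h1 := hpos (b i) (b.orthonormal.ne_zero i)
    rw [hs.apply_eigenvectorBasis, real_inner_smul_left, real_inner_self_eq_norm_sq,
      b.orthonormal.1 i] at h1
    simpa using h1.le
  let B : F →ₗ[ℝ] EuclideanSpace ℝ (Fin (Module.finrank ℝ F)) :=
    (WithLp.linearEquiv 2 ℝ (Fin (Module.finrank ℝ F) → ℝ)).symm.toLinearMap ∘ₗ
      LinearMap.pi fun i => √(c * l i) • (innerSL ℝ (b i)).toLinearMap
  have hB : ∀ u i, B u i = √(c * l i) * inner ℝ (b i) u := fun u i => rfl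
  have hnorm : ∀ u, ‖B u‖ ^ 2 = c * inner ℝ (A u) u := by
    intro u
    rw [EuclideanSpace.norm_sq_eq, ← b.sum_inner_mul_inner (A u) u, Finset.mul_sum]
    refine Finset.sum_congr rfl fun i _ => ?_
    rw [hB, Real.norm_eq_abs, sq_abs, mul_pow, Real.sq_sqrt (mul_nonneg hc.le (hl i)), hs u (b i),
      hs.apply_eigenvectorBasis]
    simp only [RCLike.ofReal_real_eq_id, id_eq, real_inner_smul_right]
    rw [real_inner_comm (b i) u]
    ring
  refine ⟨LinearEquiv.ofInjectiveOfFinrankEq B ?_ (by simp), hnorm⟩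
  rw [← LinearMap.ker_eq_bot, LinearMap.ker_eq_bot']
  intro u hu
  by_contra hu0
  have h1 := hnorm u
  rw [hu, norm_zero] at h1
  have := mul_pos hc (hpos u hu0)
  linarith

end Curvature

lemma IsPreconnected.inter_frontier_nonempty {X : Type*} [TopologicalSpace X] {s t : Set X}
    (ht : IsPreconnected t) (h1 : (t ∩ s).Nonempty) (h2 : (t ∩ sᶜ).Nonempty) :
    (t ∩ frontier s).Nonempty := by
  by_contra hne
  rw [not_nonempty_iff_eq_empty, ← disjoint_iff_inter_eq_empty, Set.disjoint_left] at hne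
  have hint : ∀ x ∈ t, x ∈ s → x ∈ interior s := fun x hxt hxs => by
    by_contra h
    exact hne hxt ⟨subset_closure hxs, h⟩
  have hext : ∀ x ∈ t, x ∉ s → x ∈ (closure s)ᶜ := fun x hxt hxs h =>
    hne hxt ⟨h, fun hi => hxs (interior_subset hi)⟩
  obtain ⟨x, hxt, hxs⟩ := h1
  obtain ⟨y, hyt, hys⟩ := h2
  obtain ⟨w, -, hw1, hw2⟩ := ht (interior s) (closure s)ᶜ isOpen_interior
    isClosed_closure.isOpen_compl (fun w hw => by
      by_cases hws : w ∈ s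
      · exact Or.inl (hint w hw hws)
      · exact Or.inr (hext w hw hws))
    ⟨x, hxt, hint x hxt hxs⟩ ⟨y, hyt, hext y hyt hys⟩
  exact hw2 (subset_closure (interior_subset hw1))

/-! ### From a boundary graph to a local epigraph. -/

section Epigraph

variable {E : Type*} [NormedAddCommGroup E] [InnerProductSpace ℝ E]

lemma inner_add_sub_smul_normal {x N : E} (hN : ‖N‖ = 1) (u : (ℝ ∙ N)ᗮ) (s : ℝ) :
    inner ℝ (x + (u : E) - s • N - x) N = -s := by
  have hu : inner ℝ (u : E) N = 0 := Submodule.mem_orthogonal_singleton_iff_inner_left.1 u.2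
  have : x + (u : E) - s • N - x = u - s • N := by abel
  rw [this, inner_sub_left, hu, real_inner_smul_left, real_inner_self_eq_norm_sq, hN]
  ring

lemma exists_eq_add_sub_smul_normal {N : E} (hN : ‖N‖ = 1) (x y : E) :
    ∃ (u : (ℝ ∙ N)ᗮ) (s : ℝ), y = x + (u : E) - s • N ∧ ‖u‖ ≤ 2 * ‖y - x‖ ∧ |s| ≤ ‖y - x‖ := by
  set s : ℝ := -inner ℝ (y - x) N
  have hs : |s| ≤ ‖y - x‖ := by
    simp only [s, abs_neg]
    have := abs_real_inner_le_norm (y - x) N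
    rwa [hN, mul_one] at this
  refine ⟨⟨y - x + s • N, ?_⟩, s, ?_, ?_, hs⟩
  · rw [Submodule.mem_orthogonal_singleton_iff_inner_left, inner_add_left, real_inner_smul_left,
      real_inner_self_eq_norm_sq, hN]
    simp only [s]; ring
  · simp only; abel
  · rw [Submodule.coe_norm]
    refine (norm_add_le _ _).trans ?_
    rw [norm_smul, hN, mul_one, Real.norm_eq_abs]
    linarith

/-- If near `x` the boundary of `K` is the graph of a convex function, then near `x` the set `K` is
the epigraph of this function. -/
lemma eventually_mem_iff_le {K : Set E} (hK : Convex ℝ K) (hKc : IsClosed K)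
    (hi : (interior K).Nonempty) {x N : E} (hx : x ∈ K) (hN : IsOuterUnitNormal K x N)
    {U : Set (ℝ ∙ N)ᗮ} {f : (ℝ ∙ N)ᗮ → ℝ} (hU : IsOpen U) (hU0 : 0 ∈ U) (hf : ConvexOn ℝ U f)
    (hW : ∃ W ∈ 𝓝 x, ∀ p ∈ W, p ∈ frontier K ↔ ∃ u ∈ U, p = x + (u : E) - f u • N) :
    ∀ᶠ p : (ℝ ∙ N)ᗮ × ℝ in 𝓝 0, x + (p.1 : E) - p.2 • N ∈ K ↔ f p.1 ≤ p.2 := by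
  obtain ⟨W, hWx, hW⟩ := hW
  set φ : (ℝ ∙ N)ᗮ × ℝ → E := fun p => x + (p.1 : E) - p.2 • N
  have hφ : Continuous φ := by fun_prop
  have hφ0 : φ 0 = x := by simp [φ]
  have hev : ∀ᶠ p : (ℝ ∙ N)ᗮ × ℝ in 𝓝 0, φ p ∈ W ∧ p.1 ∈ U :=
    ((hφ.tendsto' 0 x hφ0).eventually hWx).and
      ((continuous_fst.tendsto' (0 : (ℝ ∙ N)ᗮ × ℝ) 0 rfl).eventually (hU.eventually_mem hU0))
  obtain ⟨r, hr, H⟩ := Metric.eventually_nhds_iff_ball.1 hev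
  have hball : ∀ p : (ℝ ∙ N)ᗮ × ℝ, p ∈ Metric.ball (0 : (ℝ ∙ N)ᗮ × ℝ) r ↔
      ‖p.1‖ < r ∧ |p.2| < r := by
    intro p; rw [mem_ball_zero_iff, Prod.norm_def, max_lt_iff, Real.norm_eq_abs]
  have hfr : ∀ p ∈ Metric.ball (0 : (ℝ ∙ N)ᗮ × ℝ) r, φ p ∈ frontier K ↔ p.2 = f p.1 := by
    intro p hp
    rw [hW _ (H p hp).1]
    constructor
    · rintro ⟨u, -, hpu⟩
      have h1 := inner_add_sub_smul_normal (x := x) hN.1 p.1 p.2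
      have h2 := inner_add_sub_smul_normal (x := x) hN.1 u (f u)
      rw [← hpu, h1] at h2
      have h3 : p.2 = f u := by linarith
      have h4 : p.1 = u := by
        have : x + (p.1 : E) - p.2 • N = x + (u : E) - f u • N := hpu
        rw [h3] at this
        exact Subtype.ext (add_left_cancel (sub_left_injective this))
      rw [h4, h3]
    · intro h
      exact ⟨p.1, (H p hp).2, by rw [← h]⟩
  have hneg : ∀ p : (ℝ ∙ N)ᗮ × ℝ, p.2 < 0 → φ p ∉ K := by
    intro p hp hpK
    have h1 := hN.2 _ hpK
    rw [inner_add_sub_smul_normal hN.1] at h1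
    linarith
  have hbelow : ∀ p ∈ Metric.ball (0 : (ℝ ∙ N)ᗮ × ℝ) r, φ p ∈ K → f p.1 ≤ p.2 := by
    intro p hp hpK
    by_contra! hlt
    have hp2 : 0 ≤ p.2 := by
      by_contra! h; exact hneg p h hpK
    have hpr := (hball p).1 hp
    rw [abs_of_nonneg hp2] at hpr
    -- A vertical segment from below the supporting hyperplane, hence outside `K`, up to `φ p`: it
    -- must cross the frontier, but lies under the graph.
    have hpre : IsPreconnected ((fun s : ℝ => φ (p.1, s)) '' Icc (-(r / 2)) p.2) :=
      isPreconnected_Icc.image _ (by fun_prop)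
    obtain ⟨_, ⟨s, hs, rfl⟩, hsf⟩ := hpre.inter_frontier_nonempty (s := K)
      ⟨φ p, ⟨p.2, ⟨by linarith, le_rfl⟩, rfl⟩, hpK⟩
      ⟨φ (p.1, -(r / 2)), ⟨-(r / 2), ⟨le_rfl, by linarith⟩, rfl⟩, hneg _ (by simpa using hr)⟩
    have hsb : (p.1, s) ∈ Metric.ball (0 : (ℝ ∙ N)ᗮ × ℝ) r := by
      refine (hball _).2 ⟨hpr.1, abs_lt.2 ⟨by linarith [hs.1], by linarith [hs.2]⟩⟩
    have := (hfr _ hsb).1 hsf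
    simp only at this
    linarith [hs.2]
  filter_upwards [Metric.ball_mem_nhds (0 : (ℝ ∙ N)ᗮ × ℝ) hr] with p hp
  refine ⟨hbelow p hp, fun hle => ?_⟩
  rcases hle.eq_or_lt with heq | hlt
  · exact hKc.frontier_subset ((hfr p hp).2 heq.symm)
  by_contra hpK
  -- The strict epigraph in the ball is convex, hence connected, and misses the frontier. It
  -- contains an interior point of `K`, so it lies entirely in `K`.
  set S : Set ((ℝ ∙ N)ᗮ × ℝ) := Metric.ball 0 r ∩ {p | p.1 ∈ U ∧ f p.1 < p.2}
  have hS : Convex ℝ S := (convex_ball _ _).inter hf.convex_strict_epigraph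
  have hxc : x ∈ closure (interior K) := by
    rw [hK.closure_interior_eq_closure_of_nonempty_interior hi]; exact subset_closure hx
  obtain ⟨c, hc, hcx⟩ := Metric.mem_closure_iff.1 hxc (r / 2) (by positivity)
  rw [dist_comm, dist_eq_norm] at hcx
  obtain ⟨u, s, rfl, hu, hs⟩ := exists_eq_add_sub_smul_normal hN.1 x c
  have hcb : (u, s) ∈ Metric.ball (0 : (ℝ ∙ N)ᗮ × ℝ) r :=
    (hball _).2 ⟨by linarith, by simp only; linarith⟩
  have hcs : f u < s := by
    refine lt_of_le_of_ne (hbelow _ hcb (interior_subset hc)) fun heq => ?_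
    exact ((hfr _ hcb).2 heq.symm).2 hc
  obtain ⟨_, ⟨q, hq, rfl⟩, hqf⟩ :=
    (hS.isPreconnected.image φ hφ.continuousOn).inter_frontier_nonempty (s := K)
    ⟨φ (u, s), ⟨(u, s), ⟨hcb, (H _ hcb).2, hcs⟩, rfl⟩, interior_subset hc⟩
    ⟨φ p, ⟨p, ⟨hp, (H _ hp).2, hlt⟩, rfl⟩, hpK⟩
  have := (hfr q hq.1).1 hqf
  linarith [hq.2.2]

lemma isSubdifferentialAt_zero_of_eventually {F : Type*} [NormedAddCommGroup F]
    [InnerProductSpace ℝ F] {U : Set F} {f : F → ℝ} (hU0 : 0 ∈ U)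
    (hf : ConvexOn ℝ U f) (hf0 : f 0 = 0)
    (h : ∀ᶠ p : F × ℝ in 𝓝 0, f p.1 ≤ p.2 → 0 ≤ p.2) : IsSubdifferentialAt f U 0 0 := by
  have hloc : IsLocalMinOn f U 0 := by
    rw [show (0 : F × ℝ) = (0, 0) from rfl, nhds_prod_eq] at h
    obtain ⟨P, hP, Q, hQ, hPQ⟩ := eventually_prod_iff.1 h
    refine Eventually.filter_mono nhdsWithin_le_nhds ?_
    filter_upwards [hP] with u hu
    rw [hf0]
    by_contra! hneg
    obtain ⟨s, ⟨hs1, hs2⟩, hs3⟩ := (Eventually.and (Ioo_mem_nhdsLT hneg)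
      (hQ.filter_mono nhdsWithin_le_nhds)).exists
    have := hPQ hu hs3 hs1.le
    simp only at this
    linarith
  have hmin := IsMinOn.of_isLocalMinOn_of_convexOn hU0 hloc hf
  intro y hy
  rw [inner_zero_left, add_zero]
  exact hmin hy

end Epigraph

/-! ### Affine normalisation to the standard paraboloid. -/

/-- If `f` agrees to second order with a positive definite form `q`, then so does the function whose
epigraph is the sheared epigraph of `f`. -/
lemma eventually_shear {F : Type*} [NormedAddCommGroup F] [InnerProductSpace ℝ F]
    [FiniteDimensional ℝ F] {f : F → ℝ} {A : F →ₗ[ℝ] F} (hs : A.IsSymmetric)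
    (hnn : ∀ u, 0 ≤ inner ℝ (A u) u)
    (hf : ∀ ε > 0, ∀ᶠ u in 𝓝 (0 : F), |f u - inner ℝ (A u) u / 2| ≤ ε * inner ℝ (A u) u)
    (v : F) {ε : ℝ} (hε : 0 < ε) (hε1 : ε ≤ 1) :
    ∀ᶠ p : F × ℝ in 𝓝 0, 0 ≤ p.2 →
      (f (p.1 - p.2 • v) ≤ p.2 → (1 - ε) * (inner ℝ (A p.1) p.1 / 2) ≤ p.2) ∧
      ((1 + ε) * (inner ℝ (A p.1) p.1 / 2) ≤ p.2 → f (p.1 - p.2 • v) ≤ p.2) := by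
  set η : ℝ := ε / 9
  have hη : 0 < η := by positivity
  have hεη : ε = 9 * η := by simp only [η]; ring
  have c1 : Tendsto (fun p : F × ℝ => p.1 - p.2 • v) (𝓝 0) (𝓝 0) := by
    have : Continuous fun p : F × ℝ => p.1 - p.2 • v := by fun_prop
    simpa using this.tendsto 0
  have hA : Continuous A := A.continuous_of_finiteDimensional
  have c2 : Tendsto (fun p : F × ℝ => |inner ℝ (A p.1) v|) (𝓝 0) (𝓝 0) := by
    have : Continuous fun p : F × ℝ => |inner ℝ (A p.1) v| := by fun_prop
    simpa using this.tendsto 0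
  have c3 : Tendsto (fun p : F × ℝ => p.2 * (inner ℝ (A v) v / 2)) (𝓝 0) (𝓝 0) := by
    have : Continuous fun p : F × ℝ => p.2 * (inner ℝ (A v) v / 2) := by fun_prop
    simpa using this.tendsto 0
  filter_upwards [c1.eventually (hf (η / 2) (by positivity)), c2.eventually (gt_mem_nhds hη),
    c3.eventually (gt_mem_nhds hη)] with ⟨u, σ⟩ h1 h2 h3 hσ
  simp only at *
  -- The shear alters the form by terms of the shape `σ * o(1)`, which the height `σ` itself
  -- absorbs.
  have hexp : inner ℝ (A (u - σ • v)) (u - σ • v) / 2 =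
      inner ℝ (A u) u / 2 - σ * inner ℝ (A u) v + σ * (σ * (inner ℝ (A v) v / 2)) := by
    have hvu : inner ℝ (A v) u = inner ℝ (A u) v := by
      rw [hs v u, real_inner_comm]
    simp only [map_sub, map_smul, inner_sub_left, inner_sub_right, real_inner_smul_left,
      real_inner_smul_right, hvu]
    ring
  set q := inner ℝ (A u) u / 2
  set q' := inner ℝ (A (u - σ • v)) (u - σ • v) / 2
  have hq0 : 0 ≤ q' := by have := hnn (u - σ • v); simp only [q']; linarith
  have h4 := abs_le.1 h2.le
  have h5 : q' ≤ q + 2 * η * σ := by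
    have e1 := mul_le_mul_of_nonneg_left h4.1 hσ
    have e2 := mul_le_mul_of_nonneg_left h3.le hσ
    linarith
  have h6 : q - η * σ ≤ q' := by
    have e1 := mul_le_mul_of_nonneg_left h4.2 hσ
    have e2 : 0 ≤ σ * (σ * (inner ℝ (A v) v / 2)) :=
      mul_nonneg hσ (mul_nonneg hσ (by linarith [hnn v]))
    linarith
  have h7 : |f (u - σ • v) - q'| ≤ η * q' := by
    have : η / 2 * inner ℝ (A (u - σ • v)) (u - σ • v) = η * q' := by simp only [q']; ring
    rwa [this] at h1
  obtain ⟨h8, h9⟩ := abs_le.1 h7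
  have hη9 : η ≤ 1 / 9 := by simp only [η]; linarith
  constructor
  · intro h
    have e1 : (1 - η) * q' ≤ σ := by linarith
    have e2 : (1 - η) * (q - η * σ) ≤ σ := (mul_le_mul_of_nonneg_left h6 (by linarith)).trans e1
    have e3 : (1 - η) * q ≤ (1 + η) * σ := by nlinarith [mul_nonneg hσ (sq_nonneg η)]
    have e4 : (1 - ε) * (1 + η) ≤ 1 - η := by rw [hεη]; nlinarith
    rcases le_or_gt q 0 with hq | hq
    · have : (1 - ε) * q ≤ 0 := mul_nonpos_of_nonneg_of_nonpos (by linarith) hq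
      linarith
    · have e5 : (1 - ε) * q * (1 + η) ≤ σ * (1 + η) := by
        have := mul_le_mul_of_nonneg_right e4 hq.le
        linarith
      exact le_of_mul_le_mul_right e5 (by linarith)
  · intro h
    have e1 : f (u - σ • v) ≤ (1 + η) * (q + 2 * η * σ) := by
      have := mul_le_mul_of_nonneg_left h5 (show 0 ≤ 1 + η by linarith)
      linarith
    have e2 : (1 + η) * (1 + 4 * η) ≤ 1 + ε := by rw [hεη]; nlinarith
    have e3 : (1 + ε) * ((1 + η) * (q + 2 * η * σ)) ≤ (1 + ε) * σ := by
      have e4 : (1 + ε) * (2 * η * σ) ≤ 4 * η * σ := by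
        have := mul_nonneg hη.le hσ
        nlinarith
      have e5 := mul_le_mul_of_nonneg_left (add_le_add h e4) (show 0 ≤ 1 + η by linarith)
      have e6 := mul_le_mul_of_nonneg_right e2 hσ
      linarith
    exact e1.trans (le_of_mul_le_mul_left e3 (by linarith))

/-- A convex set with nonzero generalized Gauss curvature at some boundary point osculates the
standard paraboloid after an affine change of coordinates centered at a given interior point. -/
theorem HasGeneralizedGaussCurvatureAt.exists_osculates {E : Type*} [NormedAddCommGroup E]
    [InnerProductSpace ℝ E] [FiniteDimensional ℝ E] {K : Set E} (hK : Convex ℝ K)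
    (hKc : IsClosed K) {x z : E} {κ : ℝ} (hz : z ∈ interior K) (hx : x ∈ frontier K) (hκ : κ ≠ 0)
    (h : HasGeneralizedGaussCurvatureAt K x κ) :
    ∃ m : ℕ, m + 1 = Module.finrank ℝ E ∧ ∃ R : (EuclideanSpace ℝ (Fin m) × ℝ) ≃L[ℝ] E,
      Osculates {p | z + R p ∈ K} := by
  obtain ⟨N, hN, -, U, f, A, hU, hU0, hf, hf0, hW, hA, rfl⟩ := h
  have hxK : x ∈ K := hKc.frontier_subset hx
  have hepi := eventually_mem_iff_le hK hKc ⟨z, hz⟩ hxK hN hU hU0 hf hW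
  have hsnd : ∀ (u : (ℝ ∙ N)ᗮ) (s : ℝ), x + (u : E) - s • N ∈ K → 0 ≤ s := by
    intro u s hu
    have h1 := hN.2 _ hu
    rw [inner_add_sub_smul_normal hN.1] at h1
    linarith
  have h0 : IsSubdifferentialAt f U 0 0 := by
    refine isSubdifferentialAt_zero_of_eventually hU0 hf hf0 ?_
    filter_upwards [hepi] with p hp hle
    exact hsnd _ _ (hp.2 hle)
  have hsymm := hA.isSymmetric hU hU0 hf hf0 h0
  have hnn := hA.inner_self_nonneg hU hU0 hf hf0 h0
  -- the support height of `K` in the direction `N`, seen from `z`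
  set b : ℝ := inner ℝ (x - z) N
  have hb : 0 < b := by
    have hN0 : ‖N‖ = 1 := hN.1
    obtain ⟨ρ, hρ, hρK⟩ := Metric.nhds_basis_closedBall.mem_iff.1 (mem_interior_iff_mem_nhds.1 hz)
    have h1 := hN.2 (z + ρ • N) (hρK (by
      rw [Metric.mem_closedBall, dist_eq_norm, add_sub_cancel_left, norm_smul, hN0, mul_one,
        Real.norm_eq_abs, abs_of_pos hρ]))
    have h2 : z + ρ • N - x = ρ • N - (x - z) := by abel
    rw [h2, inner_sub_left, real_inner_smul_left, real_inner_self_eq_norm_sq, hN0] at h1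
    simp only [b]; linarith
  -- The chart measures height in units of `b`, so the form is scaled by `b⁻¹` to obtain exactly
  -- `‖g‖ ^ 2 / 2`.
  obtain ⟨B, hB⟩ := exists_linearEquiv_norm_sq_eq hsymm
    (fun u hu => hA.inner_self_pos hU hU0 hf hf0 h0 hκ hu) (inv_pos.2 hb)
  have hfq : ∀ ε > 0, ∀ᶠ u in 𝓝 (0 : (ℝ ∙ N)ᗮ),
      |f u - inner ℝ (A u) u / 2| ≤ ε * inner ℝ (A u) u := by
    intro ε hε
    set C := ‖B.symm.toContinuousLinearEquiv.toContinuousLinearMap‖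
    have hC : ∀ u : (ℝ ∙ N)ᗮ, ‖u‖ ^ 2 ≤ (C ^ 2 * b⁻¹) * inner ℝ (A u) u := by
      intro u
      have h1 := B.symm.toContinuousLinearEquiv.toContinuousLinearMap.le_opNorm (B u)
      have h2 : B.symm.toContinuousLinearEquiv.toContinuousLinearMap (B u) = u :=
        B.symm_apply_apply u
      rw [h2] at h1
      calc ‖u‖ ^ 2 ≤ (C * ‖B u‖) ^ 2 := by gcongr
        _ = (C ^ 2 * b⁻¹) * inner ℝ (A u) u := by rw [mul_pow, hB]; ring
    set D := C ^ 2 * b⁻¹ + 1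
    have hD : 0 < D := by positivity
    filter_upwards [hA.eventually_abs_sub_le hU hU0 hf hf0 h0 (div_pos hε hD)] with u hu
    refine hu.trans ?_
    have h1 : ‖u‖ ^ 2 ≤ D * inner ℝ (A u) u := by
      have := hC u
      have := hnn u
      simp only [D]; linarith
    calc ε / D * ‖u‖ ^ 2 ≤ ε / D * (D * inner ℝ (A u) u) := by gcongr
      _ = ε * inner ℝ (A u) u := by field_simp
  have hNN : inner ℝ N N = (1 : ℝ) := by rw [real_inner_self_eq_norm_sq, hN.1]; norm_num
  -- `x - z = b • (v + N)`. The chart's vertical axis is `x - z` rather than `N`, so that `z` goes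
  -- to the origin and `x` to `(0, 1)`; `v` is the resulting shear.
  set v : (ℝ ∙ N)ᗮ := ⟨b⁻¹ • (x - z) - N, by
    rw [Submodule.mem_orthogonal_singleton_iff_inner_left, inner_sub_left, real_inner_smul_left,
      hNN, inv_mul_cancel₀ hb.ne', sub_self]⟩
  have hrank : Module.finrank ℝ (ℝ ∙ N)ᗮ + 1 = Module.finrank ℝ E := by
    have h1 := Submodule.finrank_add_finrank_orthogonal (ℝ ∙ N)
    rw [finrank_span_singleton (by rintro rfl; simp at hNN)] at h1
    omega
  let R₀ : (EuclideanSpace ℝ (Fin (Module.finrank ℝ (ℝ ∙ N)ᗮ)) × ℝ) →ₗ[ℝ] E :=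
    ((ℝ ∙ N)ᗮ.subtype ∘ₗ B.symm.toLinearMap).coprod (LinearMap.toSpanSingleton ℝ E (x - z))
  have hR₀ : ∀ p, R₀ p = (B.symm p.1 : E) + p.2 • (x - z) := fun p => rfl
  have hinj : Function.Injective R₀ := by
    rw [← LinearMap.ker_eq_bot, LinearMap.ker_eq_bot']
    intro p hp
    rw [hR₀] at hp
    have hu : inner ℝ (B.symm p.1 : E) N = 0 :=
      Submodule.mem_orthogonal_singleton_iff_inner_left.1 (B.symm p.1).2
    have h1 : inner ℝ ((B.symm p.1 : E) + p.2 • (x - z)) N = 0 := by rw [hp, inner_zero_left]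
    rw [inner_add_left, hu, real_inner_smul_left, zero_add] at h1
    have h2 : p.2 = 0 := (mul_eq_zero.1 h1).resolve_right hb.ne'
    rw [h2, zero_smul, add_zero] at hp
    have h3 : p.1 = 0 := B.symm.map_eq_zero_iff.1 (Subtype.ext hp)
    exact Prod.ext h3 h2
  refine ⟨_, hrank, (LinearEquiv.ofInjectiveOfFinrankEq R₀ hinj (by simp [hrank]))
    |>.toContinuousLinearEquiv, ?_⟩
  have hR : ∀ p, (LinearEquiv.ofInjectiveOfFinrankEq R₀ hinj (by simp [hrank])
    |>.toContinuousLinearEquiv) p = (B.symm p.1 : E) + p.2 • (x - z) := fun p => rfl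
  simp only [hR]
  have hform : ∀ (g : EuclideanSpace ℝ (Fin (Module.finrank ℝ (ℝ ∙ N)ᗮ))) (s : ℝ),
      z + ((B.symm g : E) + (1 - s) • (x - z)) =
        x + ((B.symm g - (s * b) • v : (ℝ ∙ N)ᗮ) : E) - (s * b) • N := by
    intro g s
    have h1 : (s * b) • (b⁻¹ • (x - z) - N) = s • (x - z) - (s * b) • N := by
      rw [smul_sub, smul_smul, mul_assoc, mul_inv_cancel₀ hb.ne', mul_one]
    rw [Submodule.coe_sub, Submodule.coe_smul]
    simp only [v]
    rw [h1, sub_smul, one_smul]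
    abel
  refine ⟨?_, fun ε hε hε1 => ?_⟩
  · rintro ⟨g, t⟩ hg
    obtain ⟨s, rfl⟩ : ∃ s, t = 1 - s := ⟨1 - t, by ring⟩
    simp only [mem_ofPred_eq] at hg
    rw [hform] at hg
    have := hsnd _ _ hg
    have := nonneg_of_mul_nonneg_left this hb
    simp only; linarith
  have hBc : Continuous B.symm := B.symm.toLinearMap.continuous_of_finiteDimensional
  have c1 : Tendsto (fun p : EuclideanSpace ℝ (Fin (Module.finrank ℝ (ℝ ∙ N)ᗮ)) × ℝ =>
      ((B.symm p.1 - (p.2 * b) • v, p.2 * b) : (ℝ ∙ N)ᗮ × ℝ)) (𝓝 0) (𝓝 0) := by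
    have : Continuous fun p : EuclideanSpace ℝ (Fin (Module.finrank ℝ (ℝ ∙ N)ᗮ)) × ℝ =>
      ((B.symm p.1 - (p.2 * b) • v, p.2 * b) : (ℝ ∙ N)ᗮ × ℝ) := by fun_prop
    exact this.tendsto' 0 0 (by simp)
  have c2 : Tendsto (fun p : EuclideanSpace ℝ (Fin (Module.finrank ℝ (ℝ ∙ N)ᗮ)) × ℝ =>
      ((B.symm p.1, p.2 * b) : (ℝ ∙ N)ᗮ × ℝ)) (𝓝 0) (𝓝 0) := by
    have : Continuous fun p : EuclideanSpace ℝ (Fin (Module.finrank ℝ (ℝ ∙ N)ᗮ)) × ℝ =>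
      ((B.symm p.1, p.2 * b) : (ℝ ∙ N)ᗮ × ℝ) := by fun_prop
    exact this.tendsto' 0 0 (by simp)
  obtain ⟨r, hr, H⟩ := Metric.eventually_nhds_iff_ball.1 ((c1.eventually hepi).and
    (c2.eventually (eventually_shear hsymm hnn hfq v hε hε1)))
  refine ⟨r, hr, fun g s hg hs => ?_⟩
  obtain ⟨h1, h2⟩ := H (g, s) (by
    rw [mem_ball_zero_iff, Prod.norm_def, max_lt_iff, Real.norm_eq_abs]; exact ⟨hg, hs⟩)
  simp only at h1 h2
  have hnorm : inner ℝ (A (B.symm g)) (B.symm g) = b * ‖g‖ ^ 2 := by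
    have := hB (B.symm g)
    rw [B.apply_symm_apply] at this
    rw [this, mul_inv_cancel_left₀ hb.ne']
  rw [hnorm] at h2
  simp only [mem_ofPred_eq]
  rw [hform, h1]
  refine ⟨fun hle => ?_, fun hle => ?_⟩
  · have h3 := (h2 (hsnd _ _ (h1.2 hle))).1 hle
    refine le_of_mul_le_mul_right ?_ hb
    linarith
  · have hs0 : 0 ≤ s := le_trans (by positivity) hle
    refine (h2 (mul_nonneg hs0 hb.le)).2 ?_
    have := mul_le_mul_of_nonneg_right hle hb.le
    linarith

/-! ### Transport to Euclidean space and the conclusion. -/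

lemma exists_addHaar_preimage_eq_mul {V W : Type*} [NormedAddCommGroup V] [NormedSpace ℝ V]
    [MeasurableSpace V] [BorelSpace V] [NormedAddCommGroup W] [NormedSpace ℝ W]
    [FiniteDimensional ℝ W] [MeasurableSpace W] [BorelSpace W] (μ : Measure V)
    [μ.IsAddHaarMeasure] (ν : Measure W) [ν.IsAddHaarMeasure] (e : V ≃L[ℝ] W) :
    ∃ c : ENNReal, c ≠ 0 ∧ c ≠ ⊤ ∧ ∀ s : Set W, μ (e ⁻¹' s) = c * ν s := by
  have : (μ.map e).IsAddHaarMeasure := e.isAddHaarMeasure_map μ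
  refine ⟨(Measure.addHaarScalarFactor (μ.map e) ν : ENNReal), ?_, ENNReal.coe_ne_top, fun s => ?_⟩
  · exact ENNReal.coe_ne_zero.2 (Measure.addHaarScalarFactor_pos_of_isAddHaarMeasure _ _).ne'
  · have h1 := Measure.isAddLeftInvariant_eq_smul (μ.map e) ν
    have h2 : μ.map e s = μ (e ⁻¹' s) := e.toHomeomorph.toMeasurableEquiv.map_apply s
    rw [← h2]
    conv_lhs => rw [h1]
    rfl

/-- The adjoint of a linear isomorphism `G × ℝ ≃ E` with respect to the pairing on `G × ℝ`. -/
lemma exists_pairing_adjoint {E G : Type*} [NormedAddCommGroup E] [InnerProductSpace ℝ E]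
    [FiniteDimensional ℝ E] [NormedAddCommGroup G] [InnerProductSpace ℝ G] [FiniteDimensional ℝ G]
    (R : (G × ℝ) ≃L[ℝ] E) :
    ∃ S : E ≃L[ℝ] (G × ℝ), ∀ y q, pairing (S y) q = inner ℝ y (R q) := by
  have : CompleteSpace E := FiniteDimensional.complete ℝ E
  have : CompleteSpace G := FiniteDimensional.complete ℝ G
  let R₁ : G →L[ℝ] E := R.toContinuousLinearMap.comp (ContinuousLinearMap.inl ℝ G ℝ)
  let S₀ : E →ₗ[ℝ] (G × ℝ) :=
    (ContinuousLinearMap.adjoint R₁).toLinearMap.prod (innerSL ℝ (R (0, 1))).toLinearMap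
  have hS₀ : ∀ y q, pairing (S₀ y) q = inner ℝ y (R q) := by
    intro y q
    have h1 : pairing (S₀ y) q =
        inner ℝ (ContinuousLinearMap.adjoint R₁ y) q.1 + inner ℝ (R (0, 1)) y * q.2 := rfl
    have h2 : R q = R₁ q.1 + q.2 • R (0, 1) := by
      have hq : q = (q.1, 0) + q.2 • ((0 : G), (1 : ℝ)) := by ext <;> simp
      conv_lhs => rw [hq, map_add, map_smul]
      rfl
    rw [h1, h2, ContinuousLinearMap.adjoint_inner_left, inner_add_right, real_inner_smul_right,
      real_inner_comm y, mul_comm q.2]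
  have hinj : Function.Injective S₀ := by
    rw [← LinearMap.ker_eq_bot, LinearMap.ker_eq_bot']
    intro y hy
    have h1 := hS₀ y (R.symm y)
    rw [hy, R.apply_symm_apply] at h1
    have h2 : pairing (0 : G × ℝ) (R.symm y) = 0 := by simp [pairing]
    rw [h2] at h1
    exact inner_self_eq_zero.1 h1.symm
  exact ⟨(LinearEquiv.ofInjectiveOfFinrankEq S₀ hinj
    R.toLinearEquiv.finrank_eq.symm).toContinuousLinearEquiv, hS₀⟩

/-- Near a convex body with nonzero generalized Gauss curvature at some boundary point there is a
convex body with smaller volume product, the polars being taken with respect to `z`. -/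
theorem exists_convexBody_volume_product_lt {n : ℕ} (hn : 2 ≤ n)
    (K : ConvexBody (EuclideanSpace ℝ (Fin n))) {x z : EuclideanSpace ℝ (Fin n)} {κ : ℝ}
    (hz : z ∈ interior (K : Set (EuclideanSpace ℝ (Fin n))))
    (hx : x ∈ frontier (K : Set (EuclideanSpace ℝ (Fin n)))) (hκ : κ ≠ 0)
    (hcurv : HasGeneralizedGaussCurvatureAt (K : Set (EuclideanSpace ℝ (Fin n))) x κ)
    {r : ℝ} (hr : 0 < r) :
    ∃ L : ConvexBody (EuclideanSpace ℝ (Fin n)), dist L K < r ∧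
      z ∈ interior (L : Set (EuclideanSpace ℝ (Fin n))) ∧
      (z = 0 → (∀ x ∈ K, -x ∈ K) → ∀ x ∈ L, -x ∈ L) ∧
      volume (L : Set (EuclideanSpace ℝ (Fin n))) *
          volume (polarBody (L : Set (EuclideanSpace ℝ (Fin n))) z) <
        volume (K : Set (EuclideanSpace ℝ (Fin n))) *
          volume (polarBody (K : Set (EuclideanSpace ℝ (Fin n))) z) := by
  obtain ⟨m, hm, R, hR⟩ := hcurv.exists_osculates K.convex K.isClosed hz hx hκ
  rw [finrank_euclideanSpace_fin] at hm
  have : Nontrivial (EuclideanSpace ℝ (Fin m)) := by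
    apply Module.nontrivial_of_finrank_pos (R := ℝ)
    rw [finrank_euclideanSpace_fin]; omega
  obtain ⟨S, hS⟩ := exists_pairing_adjoint R
  -- the affine chart centered at `z`
  let ψ : EuclideanSpace ℝ (Fin n) ≃ₜ EuclideanSpace ℝ (Fin m) × ℝ :=
    (Homeomorph.subRight z).trans R.symm.toHomeomorph
  have hψ : ∀ y, ψ y = R.symm (y - z) := fun y => rfl
  have hψ' : ∀ q, ψ (z + R q) = q := fun q => by
    rw [hψ, add_sub_cancel_left, R.symm_apply_apply]
  have hψR : ∀ y, z + R (ψ y) = y := fun y => by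
    rw [hψ, R.apply_symm_apply, add_sub_cancel]
  have hψc : ∀ X : Set (EuclideanSpace ℝ (Fin m) × ℝ), Convex ℝ X → Convex ℝ (ψ ⁻¹' X) := by
    intro X hX
    have h1 : ψ ⁻¹' X = (fun y => y + -z) ⁻¹' (R.symm.toLinearMap ⁻¹' X) := by
      ext y
      rw [mem_preimage, hψ, sub_eq_add_neg]
      rfl
    rw [h1]
    exact (hX.linear_preimage R.symm.toLinearMap).translate_preimage_left (-z)
  set A : Set (EuclideanSpace ℝ (Fin m) × ℝ) := {p | z + R p ∈ K}
  have hKA : (K : Set (EuclideanSpace ℝ (Fin n))) = ψ ⁻¹' A := by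
    ext y
    simp only [A, mem_preimage, mem_ofPred_eq, hψR]
    rfl
  have hAψ : A = ψ.symm ⁻¹' (K : Set (EuclideanSpace ℝ (Fin n))) := by
    rw [hKA, ← preimage_comp]; simp
  have hAcompact : IsCompact A := by
    rw [hAψ, ← ψ.image_eq_preimage_symm]; exact K.isCompact.image ψ.continuous
  have hAconv : Convex ℝ A := by
    have := (K.convex.translate_preimage_right z).linear_preimage R.toLinearMap
    exact this
  have hψz : ψ z = 0 := by rw [hψ, sub_self, map_zero]
  have hA0 : 0 ∈ interior A := by
    rw [hKA, ← ψ.preimage_interior, mem_preimage, hψz] at hz; exact hz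
  obtain ⟨D', hD'⟩ := K.isCompact.isBounded.subset_closedBall z
  set D : ℝ := max D' 1
  have hD : 0 < D := lt_of_lt_of_le one_pos (le_max_right _ _)
  have hKD : ∀ y ∈ K, ‖y - z‖ ≤ D := fun y hy => by
    have := hD' hy
    rw [Metric.mem_closedBall, dist_eq_norm] at this
    exact this.trans (le_max_left _ _)
  -- `L` and `A` each contain the other shrunk by `1 - δ`. With `δ ≤ 1 / 2`, points of `L` are
  -- within `2 * D` of `z`, so the Hausdorff distance is at most `2 * δ * D < r`.
  set δ : ℝ := min (1 / 2) (r / (4 * D))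
  have hδ : 0 < δ := by positivity
  have hδ2 : δ ≤ 1 / 2 := min_le_left _ _
  have hδD : 4 * (δ * D) ≤ r := by
    have : δ ≤ r / (4 * D) := min_le_right _ _
    rw [le_div_iff₀ (by positivity)] at this
    linarith
  obtain ⟨L₀, hLc, hL, hL0, hAL, hLA, hsym, hlt⟩ :=
    hR.exists_volume_product_lt (volume : Measure (EuclideanSpace ℝ (Fin m))) hAconv hAcompact hA0
      hδ (by linarith)
  let L : ConvexBody (EuclideanSpace ℝ (Fin n)) :=
    ⟨ψ ⁻¹' L₀, hψc L₀ hL, ψ.isCompact_preimage.2 hLc,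
      ⟨z, by rw [mem_preimage, hψz]; exact interior_subset hL0⟩⟩
  have hLcoe : (L : Set (EuclideanSpace ℝ (Fin n))) = ψ ⁻¹' L₀ := rfl
  refine ⟨L, ?_, ?_, ?_, ?_⟩
  · have hmove : ∀ q, dist (z + R q) (z + R ((1 - δ) • q)) = δ * ‖R q‖ := by
      intro q
      rw [dist_add_left, dist_eq_norm, map_smul, sub_smul, one_smul, sub_sub_cancel, norm_smul,
        Real.norm_eq_abs, abs_of_pos hδ]
    rw [← ConvexBody.hausdorffDist_coe]
    refine lt_of_le_of_lt (Metric.hausdorffDist_le_of_mem_dist (r := 2 * (δ * D)) (by positivity)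
      ?_ ?_) (by nlinarith [mul_pos hδ hD])
    · intro y hy
      refine ⟨z + R ((1 - δ) • ψ y), hLA _ hy, ?_⟩
      have h1 := hKD _ (hLA _ hy)
      rw [add_sub_cancel_left, map_smul, norm_smul, Real.norm_eq_abs,
        abs_of_pos (by linarith)] at h1
      have h2 := hmove (ψ y)
      rw [hψR] at h2
      rw [h2]
      have h3 : ‖R (ψ y)‖ ≤ 2 * D := by nlinarith [norm_nonneg (R (ψ y))]
      nlinarith
    · intro y hy
      have hyA : ψ y ∈ A := by rw [hKA] at hy; exact hy
      refine ⟨z + R ((1 - δ) • ψ y), ?_, ?_⟩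
      · rw [hLcoe, mem_preimage, hψ']; exact hAL _ hyA
      · have h2 := hmove (ψ y)
        rw [hψR] at h2
        have h1 := hKD y hy
        rw [← hψR y, add_sub_cancel_left] at h1
        rw [h2]
        nlinarith [mul_le_mul_of_nonneg_left h1 hδ.le, mul_pos hδ hD]
  · rw [hLcoe, ← ψ.preimage_interior, mem_preimage, hψz]; exact hL0
  · rintro rfl hKsym y hy
    have h1 : ∀ q ∈ A, -q ∈ A := by
      intro q hq
      have := hKsym _ hq
      simp only [A, mem_ofPred_eq, zero_add, map_neg] at this ⊢
      exact this
    have h2 := hsym h1 _ hy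
    have h3 : ψ (-y) = -ψ y := by simp only [hψ, sub_zero, map_neg]
    change ψ (-y) ∈ L₀
    rwa [h3]
  -- Bodies are pulled back by the chart and polars by the adjoint; the factors `c` and `d` are the
  -- same for `K` and `L`.
  · obtain ⟨c, hc0, hct, hc⟩ := exists_addHaar_preimage_eq_mul
      (volume : Measure (EuclideanSpace ℝ (Fin n)))
      ((volume : Measure (EuclideanSpace ℝ (Fin m))).prod (volume : Measure ℝ)) R.symm
    obtain ⟨d, hd0, hdt, hd⟩ := exists_addHaar_preimage_eq_mul
      (volume : Measure (EuclideanSpace ℝ (Fin n)))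
      ((volume : Measure (EuclideanSpace ℝ (Fin m))).prod (volume : Measure ℝ)) S
    have hvol : ∀ X : Set (EuclideanSpace ℝ (Fin m) × ℝ), volume (ψ ⁻¹' X) = c *
        (volume : Measure (EuclideanSpace ℝ (Fin m))).prod (volume : Measure ℝ) X := by
      intro X
      rw [← hc, ← measure_preimage_add_right volume (-z) (R.symm ⁻¹' X)]
      congr 1
    have hpol : ∀ X : Set (EuclideanSpace ℝ (Fin m) × ℝ),
        polarBody (ψ ⁻¹' X) z = S ⁻¹' pairingPolar X := by
      intro X
      ext y
      constructor
      · intro hy q hq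
        have := hy (z + R q) (by rw [mem_preimage, hψ']; exact hq)
        rwa [add_sub_cancel_left, ← hS] at this
      · intro hy w hw
        have := hy (ψ w) hw
        rwa [hS, hψ, R.apply_symm_apply] at this
    have hmul : ∀ a b : ENNReal, c * a * (d * b) = c * d * (a * b) := fun a b =>
      mul_mul_mul_comm c a d b
    rw [hLcoe, hKA, hpol, hpol, hvol, hvol, hd, hd, hmul, hmul]
    exact ENNReal.mul_right_strictMono (mul_ne_zero hc0 hd0) (ENNReal.mul_ne_top hct hdt) hlt

/-- `0` is the midpoint of the interior points `y` and `-y`. -/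
lemma zero_mem_interior_of_neg_mem {V : Type*} [NormedAddCommGroup V] [NormedSpace ℝ V]
    {K : Set V} (hK : Convex ℝ K) (hi : (interior K).Nonempty) (hs : ∀ x ∈ K, -x ∈ K) :
    0 ∈ interior K := by
  obtain ⟨y, hy⟩ := hi
  have h1 : -y ∈ interior K := by
    have h2 : (Homeomorph.neg V) ⁻¹' K = K := by
      ext x
      exact ⟨fun h => by simpa using hs _ h, fun h => hs x h⟩
    have h3 : (Homeomorph.neg V) ⁻¹' interior K = interior K := by
      rw [(Homeomorph.neg V).preimage_interior, h2]
    rw [← h3] at hy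
    exact hy
  have := hK.interior hy h1 (show (0 : ℝ) ≤ 1 / 2 by norm_num) (show (0 : ℝ) ≤ 1 / 2 by norm_num)
    (by norm_num)
  simpa using this

theorem theorem1 (n : ℕ) (hn : 2 ≤ n) (K : ConvexBody (EuclideanSpace ℝ (Fin n)))
    (hK : (interior (K : Set (EuclideanSpace ℝ (Fin n)))).Nonempty)
    (hcurv : ∃ x ∈ frontier (K : Set (EuclideanSpace ℝ (Fin n))), ∃ κ : ℝ,
      κ ≠ 0 ∧ HasGeneralizedGaussCurvatureAt (K : Set (EuclideanSpace ℝ (Fin n))) x κ) :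
    -- neighbourhoods of `K` are taken in the Hausdorff metric, the metric of `ConvexBody`
    (¬ IsLocalMinOn
        (fun L : ConvexBody (EuclideanSpace ℝ (Fin n)) =>
          volume (L : Set (EuclideanSpace ℝ (Fin n))) *
            volume (polarBody (L : Set (EuclideanSpace ℝ (Fin n)))
              (santaloPoint (L : Set (EuclideanSpace ℝ (Fin n))))))
        {L | (interior (L : Set (EuclideanSpace ℝ (Fin n)))).Nonempty} K) ∧
    ((∀ x ∈ K, -x ∈ K) →
      ¬ IsLocalMinOn
        (fun L : ConvexBody (EuclideanSpace ℝ (Fin n)) =>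
          volume (L : Set (EuclideanSpace ℝ (Fin n))) *
            volume (polarBody (L : Set (EuclideanSpace ℝ (Fin n))) 0))
        {L | (interior (L : Set (EuclideanSpace ℝ (Fin n)))).Nonempty ∧ ∀ x ∈ L, -x ∈ L} K) := by
  obtain ⟨x, hx, κ, hκ, hcurv⟩ := hcurv
  refine ⟨fun hmin => ?_, fun hsym hmin => ?_⟩
  · obtain ⟨r, hr, H⟩ := Metric.mem_nhdsWithin_iff.1 hmin
    obtain ⟨L, hLK, hzL, -, hlt⟩ := exists_convexBody_volume_product_lt hn K
      (isSantaloPoint_santaloPoint K hK).1 hx hκ hcurv hr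
    have hle := H ⟨hLK, (⟨_, hzL⟩ : (interior (L : Set (EuclideanSpace ℝ (Fin n)))).Nonempty)⟩
    -- Passing from the Santaló point of `K` to that of `L` can only lower the volume of the polar
    -- of `L`.
    have hs := (isSantaloPoint_santaloPoint L ⟨_, hzL⟩).2 _ hzL
    exact absurd (lt_of_le_of_lt (mul_le_mul_right hs _) hlt) (not_lt.2 hle)
  · obtain ⟨r, hr, H⟩ := Metric.mem_nhdsWithin_iff.1 hmin
    obtain ⟨L, hLK, hzL, hLsym, hlt⟩ := exists_convexBody_volume_product_lt hn K
      (zero_mem_interior_of_neg_mem K.convex hK hsym) hx hκ hcurv hr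
    have hmem : (interior (L : Set (EuclideanSpace ℝ (Fin n)))).Nonempty ∧ ∀ x ∈ L, -x ∈ L :=
      ⟨⟨_, hzL⟩, hLsym rfl hsym⟩
    exact absurd hlt (not_lt.2 (H ⟨hLK, hmem⟩))
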